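/- Let $n\ge 2$ and let $0<m<\kappa$ be integers. On $\mathbb{R}^{2n}\times S^1$, $S^1=\mathbb{R}/\mathbb{Z}$, with coordinates $x,y\in\mathbb{R}^n$ and $t\in S^1$, take the contact structure $\ker(dt-\alpha)$, $\alpha=\frac12(y\,dx-x\,dy)$. For $R>0$ let $B(R)=\{w\in\mathbb{R}^{2n}:\pi|w|^2<R\}$ and $\widehat B(R)=B(R)\times S^1$. A contact squeezing of an open set $U_1$ into an open set $U_2$ within an open set $W$ is a contact isotopy $\{\phi_t\}_{t\in[0,1]}$, $\phi_0=\mathrm{id}$, supported in a compact subset of $W$, such that $\phi_1(\overline{U_1})\subset U_2$. Then there is a contact squeezing of $\widehat B(m/\kappa)$ into itself within an arbitrarily small neighborhood of (the closure of) $\widehat B(m/(\kappa-m))$: for every open set $W$ containing $\overline{\widehat B(m/(\kappa-m))}$ there is a contact squeezing of $\widehat B(m/\kappa)$ into itself within $W$. -/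

import Mathlib

open scoped Manifold ContDiff InnerProductSpace ComplexConjugate

noncomputable section

namespace ContactSqueezing

/-- One block of `n` real coordinates. -/
abbrev E (n : ℕ) : Type := EuclideanSpace ℝ (Fin n)

/-- The manifold `ℝ²ⁿ × S¹`. A point is `((x, y), e)`, with `x, y ∈ ℝⁿ` and `e` on the unit circle of
`ℂ`; the circle `S¹ = ℝ/ℤ` is identified with the unit circle through `t ↦ e = exp (2πit)`. -/
abbrev V (n : ℕ) : Type := (E n × E n) × Circle

/-- The model with corners of the smooth manifold `ℝ²ⁿ × S¹`. -/
abbrev model (n : ℕ) : ModelWithCorners ℝ ((E n × E n) × EuclideanSpace ℝ (Fin 1))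
    (ModelProd (E n × E n) (EuclideanSpace ℝ (Fin 1))) :=
  𝓘(ℝ, E n × E n).prod (𝓡 1)

/-- The differential at `p` of the coordinate `x` (first block), applied to a tangent vector. -/
def dx {n : ℕ} (p : V n) (v : TangentSpace (model n) p) : E n :=
  mfderiv (model n) 𝓘(ℝ, E n) (fun q : V n => q.1.1) p v

/-- The differential at `p` of the coordinate `y` (second block), applied to a tangent vector. -/
def dy {n : ℕ} (p : V n) (v : TangentSpace (model n) p) : E n :=
  mfderiv (model n) 𝓘(ℝ, E n) (fun q : V n => q.1.2) p v

/-- The differential at `p` of `e = exp (2πit)`, as a map to `ℂ`, applied to a tangent vector. -/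
def de {n : ℕ} (p : V n) (v : TangentSpace (model n) p) : ℂ :=
  mfderiv (model n) 𝓘(ℝ, ℂ) (fun q : V n => (q.2 : ℂ)) p v

/-- The angular form `dt` on `S¹ = ℝ/ℤ`: since `e = exp (2πit)`, one has `ē de = 2πi dt`. -/
def dt {n : ℕ} (p : V n) (v : TangentSpace (model n) p) : ℝ :=
  (conj (p.2 : ℂ) * de p v).im / (2 * Real.pi)

/-- The Liouville form `α = ½ (y dx - x dy) = ½ ∑ⱼ (yⱼ dxⱼ - xⱼ dyⱼ)`, pulled back to
`ℝ²ⁿ × S¹`. -/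
def liouvilleForm {n : ℕ} (p : V n) (v : TangentSpace (model n) p) : ℝ :=
  (⟪p.1.2, dx p v⟫_ℝ - ⟪p.1.1, dy p v⟫_ℝ) / 2

/-- The contact form `dt - α`. -/
def contactForm {n : ℕ} (p : V n) (v : TangentSpace (model n) p) : ℝ :=
  dt p v - liouvilleForm p v

/-- A diffeomorphism of `ℝ²ⁿ × S¹` is a contactomorphism if its differential maps the hyperplane
`ker (dt - α)` at each point `p` onto the one at the image point (the differential is an
isomorphism, so this says that a vector lies in the first exactly if its image lies in the
second). -/
def IsContactomorphism {n : ℕ} (φ : V n ≃ₘ^∞⟮model n, model n⟯ V n) : Prop :=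
  ∀ (p : V n) (v : TangentSpace (model n) p),
    contactForm (φ p) (mfderiv (model n) (model n) φ p v) = 0 ↔ contactForm p v = 0

/-- A contact isotopy of `ℝ²ⁿ × S¹`: a family of contactomorphisms `φ t`, `t ∈ [0, 1]`, jointly
smooth in `t` and the point, and starting at the identity. (Values at other `t` play no role.) -/
structure IsContactIsotopy {n : ℕ} (φ : ℝ → V n ≃ₘ^∞⟮model n, model n⟯ V n) : Prop where
  smooth : ContMDiffOn (𝓘(ℝ, ℝ).prod (model n)) (model n) ∞
    (fun q : ℝ × V n => φ q.1 q.2) (Set.Icc 0 1 ×ˢ Set.univ)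
  start : ∀ p, φ 0 p = p
  contact : ∀ t ∈ Set.Icc (0 : ℝ) 1, IsContactomorphism (φ t)

/-- The isotopy `φ t`, `t ∈ [0, 1]`, is compactly supported within `W`: there is a compact subset
of `W` outside which each `φ t` is the identity. -/
def IsCompactlySupportedIn {n : ℕ} (φ : ℝ → V n ≃ₘ^∞⟮model n, model n⟯ V n) (W : Set (V n)) :
    Prop :=
  ∃ K : Set (V n), IsCompact K ∧ K ⊆ W ∧ ∀ t ∈ Set.Icc (0 : ℝ) 1, ∀ p ∉ K, φ t p = p

/-- `φ` is a contact squeezing of `U₁` into `U₂` within `W`: a contact isotopy, compactly supported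
within `W`, whose time-one map sends the closure of `U₁` into `U₂`. -/
structure IsSqueezing {n : ℕ} (φ : ℝ → V n ≃ₘ^∞⟮model n, model n⟯ V n) (U₁ U₂ W : Set (V n)) :
    Prop where
  isotopy : IsContactIsotopy φ
  support : IsCompactlySupportedIn φ W
  squeezes : ∀ p ∈ closure U₁, φ 1 p ∈ U₂

/-- The prequantized ball `B(R) × S¹`, where `B(R) = {(x, y) : π (|x|² + |y|²) < R}` is the ball of
symplectic capacity `R`. -/
def prequantizedBall (n : ℕ) (R : ℝ) : Set (V n) :=
  {p | Real.pi * (‖p.1.1‖ ^ 2 + ‖p.1.2‖ ^ 2) < R}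

end ContactSqueezing

end

/-!
Points of `ℝ²ⁿ × S¹` are written `(z, e)`, with `z = x + √-1 y ∈ ℂⁿ` and `e` on the unit circle,
and `N = |z|²`. Put `r = κ / m > 1`. The closed prequantized ball of capacity `m / κ` is
`{π r N ≤ 1}`, and the closed one of capacity `m / (κ - m)` is `{π (r - 1) N ≤ 1}`. The squeezing
moves the first domain through domains `{π q ≤ 1}`, where `q` has degree two in `z` and depends on
`e`. The computation behind everything is a transport equation: if the contact Hamiltonian `k s`
has degree two in `z`, then along its trajectories (where `e` is constant, by Euler's identity)
one asks that `q' = τ (q - 1 / π)`, where `τ` is the derivative of `k s` in the direction of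
`∂/∂t`. Then the flow carries `{π q ≤ 1}` at time `0` into `{π q ≤ 1}` at time `1`. The
Hamiltonians are not smooth at `z = 0`, but only the level set `{π q = 1}` matters; it stays away
from `z = 0`, so that they may be cut off. If `q ≥ L N` throughout, it stays in `{π L N ≤ 1}`, and
the isotopy may be supported in any neighbourhood of this set (`exists_transport_of_bounds`).

Let `A` be the loop `e ↦ diag (e, e⁻¹)` in `SU(2)`, acting on two of the complex coordinates.
Acting by a loop of linear symplectic maps on a domain `{π q ≤ 1}` adds to (the transform of) `q`
the quadratic Hamiltonian of the loop, and a contraction of the loop gives a contact isotopy from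
the old domain to the new one (`exists_rotation_isotopy`). The Hamiltonian `D - M`, with `D`, `M`
the squared moduli of the two coordinates, is not positive, and acting with `A` decreases `q` by
at most `N`; this is where the capacity `1 / (r - 1)` comes from.

To get a positive loop, write `r = k + δ` with `k` an integer and `0 ≤ δ < 1`. For one coordinate
`ζ`, put `S = (N + |ζ|²) / 2`, `C = N - |ζ|²` and `X + √-1 Y = √N e ^ k ζ`. Then `S`, `X`, `Y`
span a copy of `sl(2, ℝ)` under the Poisson bracket, up to a factor, `C` is central, and
`S² - X² - Y² = C² / 4`. The factor `e ^ k` makes up for the summand `k N` of `q`, the Hamiltonian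
of the loop of scalars `e ^ k`, which turns `ζ` as `e` varies. Moreover `|ζ|² = S - C / 2`. The
flow generated by `Y` boosts `S` to `S cosh b - X sinh b`. This is at least `C / 2` for every `b`,
and after adding a given small positive multiple of `S` it exceeds any given multiple of `C` if
`b` is large (`half_mul_le_of_timelike`).

The proof has three steps. First `A` is switched on (`exists_unwinding`), then it is conjugated by
a boost of large rapidity (`exists_boosting`), and finally `A` is switched on once more
(`exists_contraction`). The bounds `S cosh b - X sinh b ≥ C / 2` and `M ≤ C` show that
`q ≥ (r - 1 - ε) N` throughout (`IsAdmissible.boostForm_ge`, `IsAdmissible.boostForm_sub_ge`), and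
at the end the sum of `D - M` and of its boost is positive, so that `q > r N`
(`IsAdmissible.boostForm_gt`): the ball has been moved into its interior.

Two general facts are proved on the way. Flows of smooth, bounded, Lipschitz vector fields are
smooth (`exists_smooth_flow`), by the implicit function theorem in the Banach space of continuous
paths; and compactly supported contact Hamiltonians generate contact isotopies
(`exists_contactIsotopy`).
-/

noncomputable section

namespace ContactSqueezing

open Set Filter Topology NNReal

/-! ### Smooth dependence of flows on the initial point -/

section Flow

variable {F G : Type} [NormedAddCommGroup F] [NormedSpace ℝ F]
  [NormedAddCommGroup G] [NormedSpace ℝ G]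

/-- Pointwise application of a continuous path of operators to a continuous path of vectors. -/
def pathApply (F G : Type) [NormedAddCommGroup F] [NormedSpace ℝ F]
    [NormedAddCommGroup G] [NormedSpace ℝ G] :
    C(unitInterval, F →L[ℝ] G) →L[ℝ] C(unitInterval, F) →L[ℝ] C(unitInterval, G) :=
  LinearMap.mkContinuous₂
    (LinearMap.mk₂ ℝ (fun (A : C(unitInterval, F →L[ℝ] G)) (γ : C(unitInterval, F)) =>
        (⟨fun t => A t (γ t), by fun_prop⟩ : C(unitInterval, G)))
      (fun _ _ _ => by ext; simp) (fun _ _ _ => by ext; simp)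
      (fun _ _ _ => by ext; simp) (fun _ _ _ => by ext; simp)) 1
    (fun A γ => by
      rw [one_mul]
      refine (ContinuousMap.norm_le _ (by positivity)).2 fun t => ?_
      exact (A t).le_of_opNorm_le_of_le (A.norm_coe_le_norm t) (γ.norm_coe_le_norm t))

@[simp] lemma pathApply_apply (A : C(unitInterval, F →L[ℝ] G)) (γ : C(unitInterval, F))
    (t : unitInterval) : pathApply F G A γ t = A t (γ t) := rfl

/-- Composition with a `C¹` map is differentiable on the space of continuous paths. -/
theorem hasFDerivAt_postcomp {f : C(F, G)} {f' : C(F, F →L[ℝ] G)}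
    (hf : ∀ x, HasFDerivAt f (f' x) x) (γ : C(unitInterval, F)) :
    HasFDerivAt (fun η : C(unitInterval, F) => f.comp η) (pathApply F G (f'.comp γ)) γ := by
  rw [hasFDerivAt_iff_isLittleO_nhds_zero, Asymptotics.isLittleO_iff]
  intro ε hε
  have hc : @Continuous _ _ PseudoMetricSpace.toUniformSpace.toTopologicalSpace
      PseudoMetricSpace.toUniformSpace.toTopologicalSpace
      (fun η : C(unitInterval, F) => f'.comp η) := ContinuousMap.continuous_postcomp f'
  obtain ⟨δ, hδ, hball⟩ := Metric.continuous_iff.1 hc γ ε hε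
  filter_upwards [Metric.ball_mem_nhds (0 : C(unitInterval, F)) hδ] with η hη
  rw [mem_ball_zero_iff] at hη
  refine (ContinuousMap.norm_le _ (by positivity)).2 fun t => ?_
  have key := Convex.norm_image_sub_le_of_norm_hasFDerivWithin_le' (f := f) (f' := f')
    (φ := f' (γ t)) (s := segment ℝ (γ t) (γ t + η t)) (C := ε) (x := γ t) (y := γ t + η t)
    (fun x _ => (hf x).hasFDerivWithinAt) (fun x hx => ?_) (convex_segment _ _)
    (left_mem_segment _ _ _) (right_mem_segment _ _ _)
  · have h2 : ε * ‖η t‖ ≤ ε * ‖η‖ := by gcongr; exact η.norm_coe_le_norm t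
    simpa using key.trans (by simpa using h2)
  · obtain ⟨θ, hθ, rfl⟩ := (segment_eq_image' ℝ (γ t) (γ t + η t)) ▸ hx
    have h1 : dist (γ + θ • η) γ < δ := by
      rw [dist_eq_norm, add_sub_cancel_left, norm_smul, Real.norm_of_nonneg hθ.1]
      exact lt_of_le_of_lt (mul_le_of_le_one_left (norm_nonneg _) hθ.2) hη
    have h2 := (ContinuousMap.dist_lt_iff hε).1 (hball _ h1) t
    rw [dist_eq_norm] at h2
    simpa using h2.le

theorem contDiff_postcomp_nat (n : ℕ) : ∀ {G : Type} [NormedAddCommGroup G] [NormedSpace ℝ G]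
    (f : C(F, G)), ContDiff ℝ n f → ContDiff ℝ n (fun η : C(unitInterval, F) => f.comp η) := by
  induction n with
  | zero =>
    intro G _ _ f _
    exact contDiff_zero.2 (ContinuousMap.continuous_postcomp f)
  | succ n ih =>
    intro G _ _ f hf
    have hf1 : Continuous (fderiv ℝ f) := hf.continuous_fderiv (by simp)
    have hd : Differentiable ℝ f := hf.differentiable (by simp)
    have hf2 : ContDiff ℝ n (fderiv ℝ f) := hf.fderiv_right (by simp)
    have hL : ContDiff ℝ n (pathApply F G) := by apply ContinuousLinearMap.contDiff
    have h := ih (⟨fderiv ℝ f, hf1⟩ : C(F, F →L[ℝ] G)) hf2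
    rw [Nat.cast_add, Nat.cast_one, contDiff_succ_iff_hasFDerivAt]
    refine ⟨fun γ => pathApply F G ((⟨fderiv ℝ f, hf1⟩ : C(F, F →L[ℝ] G)).comp γ),
      hL.comp h, fun γ => hasFDerivAt_postcomp (f := f) (fun x => ?_) γ⟩
    exact (hd x).hasFDerivAt

theorem contDiff_postcomp (f : C(F, G)) (hf : ContDiff ℝ ∞ f) :
    ContDiff ℝ ∞ (fun η : C(unitInterval, F) => f.comp η) :=
  contDiff_infty.2 fun n => contDiff_postcomp_nat n f (contDiff_infty.1 hf n)

/-- The primitive, vanishing at `0`, of a continuous path. -/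
def pathPrimitive (F : Type) [NormedAddCommGroup F] [NormedSpace ℝ F] [CompleteSpace F] :
    C(unitInterval, F) →L[ℝ] C(unitInterval, F) :=
  LinearMap.mkContinuous
    { toFun := fun γ => ⟨fun t => ∫ τ in (0 : ℝ)..t, γ (projIcc 0 1 zero_le_one τ), by
        have : Continuous fun τ : ℝ => γ (projIcc 0 1 zero_le_one τ) :=
          γ.continuous.comp continuous_projIcc
        exact (intervalIntegral.continuous_primitive
          (fun a b => this.intervalIntegrable a b) 0).comp continuous_subtype_val⟩
      map_add' := fun γ η => by
        ext t
        have h : ∀ γ : C(unitInterval, F), IntervalIntegrable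
            (fun τ : ℝ => γ (projIcc 0 1 zero_le_one τ)) MeasureTheory.volume 0 t := fun γ =>
          (γ.continuous.comp continuous_projIcc).intervalIntegrable _ _
        simpa using intervalIntegral.integral_add (h γ) (h η)
      map_smul' := fun a γ => by ext t; simp }
    1 (fun γ => by
      rw [one_mul]
      refine (ContinuousMap.norm_le _ (by positivity)).2 fun t => ?_
      have := intervalIntegral.norm_integral_le_of_norm_le_const (a := (0 : ℝ)) (b := t)
        (f := fun τ : ℝ => γ (projIcc 0 1 zero_le_one τ)) (C := ‖γ‖)
        (fun τ _ => γ.norm_coe_le_norm _)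
      refine this.trans ?_
      rw [sub_zero, abs_of_nonneg t.2.1]
      exact mul_le_of_le_one_right (norm_nonneg _) t.2.2)

lemma norm_pathPrimitive_le [CompleteSpace F] : ‖pathPrimitive F‖ ≤ 1 :=
  LinearMap.mkContinuous_norm_le _ zero_le_one _

/-- A path that solves the Picard equation `γ = x + r ∫ f(γ)` is determined by `x` when `r` is
small compared with the Lipschitz constant of `f`. -/
lemma picard_unique [CompleteSpace F] {f : C(F, F)} {K : ℝ≥0} (hK : LipschitzWith K f) {r : ℝ}
    (hr : |r| * K < 1) {x : F} {γ η : C(unitInterval, F)}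
    (hγ : γ - ContinuousMap.const unitInterval x - r • pathPrimitive F (f.comp γ) = 0)
    (hη : η - ContinuousMap.const unitInterval x - r • pathPrimitive F (f.comp η) = 0) : γ = η := by
  have h : γ - η = r • pathPrimitive F (f.comp γ - f.comp η) := by
    rw [map_sub, smul_sub]
    have h := sub_eq_zero.2 (hγ.trans hη.symm)
    rw [← sub_eq_zero, ← h]
    abel
  have h1 : ‖f.comp γ - f.comp η‖ ≤ K * ‖γ - η‖ := by
    refine (ContinuousMap.norm_le _ (by positivity)).2 fun t => ?_
    refine (hK.norm_sub_le (γ t) (η t)).trans ?_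
    gcongr
    exact (γ - η).norm_coe_le_norm t
  have h2 : ‖γ - η‖ ≤ |r| * K * ‖γ - η‖ := by
    calc ‖γ - η‖ = |r| * ‖pathPrimitive F (f.comp γ - f.comp η)‖ := by
          conv_lhs => rw [h, norm_smul, Real.norm_eq_abs]
      _ ≤ |r| * (1 * ‖f.comp γ - f.comp η‖) := by
          gcongr
          exact (pathPrimitive F).le_of_opNorm_le norm_pathPrimitive_le _
      _ ≤ |r| * (1 * (K * ‖γ - η‖)) := by gcongr
      _ = _ := by ring
  have h3 : ‖γ - η‖ = 0 := by nlinarith [norm_nonneg (γ - η)]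
  exact sub_eq_zero.1 (norm_eq_zero.1 h3)

/-- For a family `Γ` of integral curves of a smooth Lipschitz vector field, `(r, x) ↦ Γ x r` is
smooth for small `r`: the rescaled curve `t ↦ Γ x (r t)` solves an equation in the Banach space of
paths to which the implicit function theorem applies. -/
theorem contDiffAt_flow_of_small [CompleteSpace F] {f : F → F} (hf : ContDiff ℝ ∞ f) {K : ℝ≥0}
    (hK : LipschitzWith K f) {Γ : F → ℝ → F} (h0 : ∀ x, Γ x 0 = x)
    (hΓ : ∀ x t, HasDerivAt (Γ x) (f (Γ x t)) t) {r₀ : ℝ} (hr₀ : |r₀| * K < 1) (x₀ : F) :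
    ContDiffAt ℝ ∞ (fun q : ℝ × F => Γ q.2 q.1) (r₀, x₀) := by
  let fc : C(F, F) := ⟨f, hf.continuous⟩
  have hΓc : ∀ x, Continuous (Γ x) := fun x =>
    continuous_iff_continuousAt.2 fun t => (hΓ x t).continuousAt
  let sol : ℝ × F → C(unitInterval, F) := fun q => ⟨fun t => Γ q.2 (q.1 * t), by
    exact (hΓc q.2).comp (by fun_prop)⟩
  -- the zeros of `P (q, ·)` are the solutions of the Picard equation
  let P : (ℝ × F) × C(unitInterval, F) → C(unitInterval, F) := fun v =>
    v.2 - ContinuousMap.const unitInterval v.1.2 - v.1.1 • pathPrimitive F (fc.comp v.2)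
  have hsol : ∀ q, P (q, sol q) = 0 := by
    intro q
    ext t
    have hd : ∀ τ ∈ uIcc (0 : ℝ) t, HasDerivAt (fun τ => Γ q.2 (q.1 * τ))
        (q.1 • f (Γ q.2 (q.1 * τ))) τ := by
      intro τ _
      have h := (hΓ q.2 (q.1 * τ)).scomp τ ((hasDerivAt_id τ).const_mul q.1)
      simpa [Function.comp_def] using h
    have hint := intervalIntegral.integral_eq_sub_of_hasDerivAt hd (by
      apply Continuous.intervalIntegrable
      exact continuous_const.smul (hf.continuous.comp ((hΓc q.2).comp (by fun_prop))))
    have hcongr : ∫ τ in (0 : ℝ)..t, (fc.comp (sol q)) (projIcc 0 1 zero_le_one τ)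
        = ∫ τ in (0 : ℝ)..t, f (Γ q.2 (q.1 * τ)) := by
      apply intervalIntegral.integral_congr
      intro τ hτ
      rw [uIcc_of_le t.2.1] at hτ
      have hm : τ ∈ Icc (0 : ℝ) 1 := ⟨hτ.1, hτ.2.trans t.2.2⟩
      simp [fc, sol, projIcc_of_mem zero_le_one hm]
    have : P (q, sol q) t = Γ q.2 (q.1 * t) - q.2
        - q.1 • ∫ τ in (0 : ℝ)..t, f (Γ q.2 (q.1 * τ)) := by
      rw [← hcongr]; rfl
    rw [this, ← intervalIntegral.integral_smul, hint]
    simp [h0]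
  have hconst : ContDiff ℝ ∞ (fun x : F => ContinuousMap.const unitInterval x) := by
    let L : F →L[ℝ] C(unitInterval, F) := LinearMap.mkContinuous
      { toFun := fun x => ContinuousMap.const unitInterval x
        map_add' := fun _ _ => by ext; simp
        map_smul' := fun _ _ => by ext; simp } 1 (fun x => by
          rw [one_mul]
          exact (ContinuousMap.norm_le _ (norm_nonneg _)).2 fun _ => le_rfl)
    have hL : ContDiff ℝ ∞ L := by apply ContinuousLinearMap.contDiff
    exact hL
  have hN : ContDiff ℝ ∞ (fun η : C(unitInterval, F) => fc.comp η) := contDiff_postcomp fc hf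
  have hJ : ContDiff ℝ ∞ (pathPrimitive F) := by apply ContinuousLinearMap.contDiff
  have hev1 : ContDiff ℝ ∞ (ContinuousMap.evalCLM ℝ (M := F) (1 : unitInterval)) := by
    apply ContinuousLinearMap.contDiff
  have hP : ContDiff ℝ ∞ P := by
    refine (contDiff_snd.sub (hconst.comp (contDiff_snd.comp contDiff_fst))).sub ?_
    exact (contDiff_fst.comp contDiff_fst).smul
      (hJ.comp (hN.comp contDiff_snd))
  set u : (ℝ × F) × C(unitInterval, F) := ((r₀, x₀), sol (r₀, x₀)) with hu
  have hf1 : Continuous (fderiv ℝ f) := hf.continuous_fderiv (by simp)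
  let f'c : C(F, F →L[ℝ] F) := ⟨fderiv ℝ f, hf1⟩
  let A : C(unitInterval, F) →L[ℝ] C(unitInterval, F) :=
    r₀ • (pathPrimitive F).comp (pathApply F F (f'c.comp u.2))
  have hA : ‖A‖ < 1 := by
    refine lt_of_le_of_lt ?_ hr₀
    refine ContinuousLinearMap.opNorm_le_bound _ (by positivity) fun η => ?_
    have h1 : ‖pathApply F F (f'c.comp u.2) η‖ ≤ K * ‖η‖ := by
      refine (ContinuousMap.norm_le _ (by positivity)).2 fun t => ?_
      exact (fderiv ℝ f _).le_of_opNorm_le_of_le (norm_fderiv_le_of_lipschitz ℝ hK)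
        (η.norm_coe_le_norm t)
    calc ‖A η‖ = |r₀| * ‖pathPrimitive F (pathApply F F (f'c.comp u.2) η)‖ := by
          simp [A, norm_smul]
      _ ≤ |r₀| * (1 * (K * ‖η‖)) := by
          gcongr
          exact (pathPrimitive F).le_of_opNorm_le_of_le norm_pathPrimitive_le h1
      _ = _ := by ring
  -- the partial derivative in the path is `1 - A` with `‖A‖ < 1`, hence invertible
  have hpartial : fderiv ℝ P u ∘L .inr ℝ (ℝ × F) C(unitInterval, F) = 1 - A := by
    have h1 : HasFDerivAt (fun η => P (u.1, η))
        (fderiv ℝ P u ∘L .inr ℝ (ℝ × F) C(unitInterval, F)) u.2 :=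
      HasFDerivAt.comp u.2 (hP.differentiable (by simp) u).hasFDerivAt
        (hasFDerivAt_prodMk_right u.1 u.2)
    have h2 : HasFDerivAt (fun η => P (u.1, η)) (1 - A) u.2 := by
      have hn := hasFDerivAt_postcomp (f := fc) (f' := f'c)
        (fun x => (hf.differentiable (by simp) x).hasFDerivAt) u.2
      have hJ' : HasFDerivAt (pathPrimitive F) (pathPrimitive F) (fc.comp u.2) := by
        apply ContinuousLinearMap.hasFDerivAt
      exact ((hasFDerivAt_id u.2).sub_const (ContinuousMap.const unitInterval u.1.2)).sub
        ((hJ'.comp u.2 hn).const_smul r₀)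
    exact h1.unique h2
  have hinv : (fderiv ℝ P u ∘L .inr ℝ (ℝ × F) C(unitInterval, F)).IsInvertible := by
    rw [hpartial]
    exact ⟨ContinuousLinearEquiv.unitsEquiv ℝ _ (Units.oneSub A hA), by ext; rfl⟩
  have hPu : ContDiffAt ℝ ∞ P u := hP.contDiffAt
  have hne : (∞ : WithTop ℕ∞) ≠ 0 := by simp
  have hψ := hPu.contDiffAt_implicitFunction hne hinv
  have hev := hPu.eventually_apply_implicitFunction hne hinv
  have hPu0 : P u = 0 := hsol (r₀, x₀)
  have hsmall : ∀ᶠ q : ℝ × F in 𝓝 u.1, |q.1| * K < 1 :=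
    (Continuous.continuousAt (by fun_prop)).eventually_lt continuousAt_const hr₀
  -- by uniqueness, the implicit function is the rescaled integral curve; evaluate it at `1`
  have heq : (fun q : ℝ × F => Γ q.2 q.1) =ᶠ[𝓝 u.1]
      fun q => ContinuousMap.evalCLM ℝ (1 : unitInterval) (hPu.implicitFunction hne hinv q) := by
    filter_upwards [hev, hsmall] with q hq hqs
    have := picard_unique (f := fc) hK hqs (hsol q) (hq.trans hPu0)
    have h2 : hPu.implicitFunction hne hinv q = sol q := this.symm
    rw [h2]
    simp [sol]
  exact (hev1.contDiffAt.comp u.1 hψ).congr_of_eventuallyEq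
    heq

/-- Integral curves of a bounded Lipschitz vector field exist for all times. -/
theorem exists_global_integralCurve [CompleteSpace F] {f : F → F} {K L : ℝ≥0}
    (hK : LipschitzWith K f) (hL : ∀ x, ‖f x‖ ≤ L) (x : F) :
    ∃ γ : ℝ → F, γ 0 = x ∧ ∀ t, HasDerivAt γ (f (γ t)) t := by
  have hloc : ∀ T : ℝ, 0 < T → ∃ γ : ℝ → F, γ 0 = x ∧
      ∀ t ∈ Ioo (-T) T, HasDerivAt γ (f (γ t)) t := by
    intro T hT
    have hpl : IsPicardLindelof (fun _ => f) (tmin := -T) (tmax := T)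
        ⟨0, by simp [hT.le]⟩ x (L * T.toNNReal) 0 L K :=
      { lipschitzOnWith := fun _ _ => hK.lipschitzOnWith
        continuousOn := fun _ _ => continuousOn_const
        norm_le := fun _ _ y _ => hL y
        mul_max_le := by simp [hT.le] }
    obtain ⟨γ, h1, h2⟩ := hpl.exists_eq_forall_mem_Icc_hasDerivWithinAt₀
    exact ⟨γ, h1, fun t ht => (h2 t (Ioo_subset_Icc_self ht)).hasDerivAt (Icc_mem_nhds ht.1 ht.2)⟩
  choose! γ hγ0 hγ using hloc
  have huniq : ∀ T T', 0 < T → T ≤ T' → EqOn (γ T) (γ T') (Ioo (-T) T) := by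
    intro T T' hT hTT'
    refine ODE_solution_unique_of_mem_Ioo (v := fun _ => f) (s := fun _ => univ) (t₀ := 0)
      (fun _ _ => hK.lipschitzOnWith) ⟨by linarith, hT⟩ (fun t ht => ⟨hγ T hT t ht, trivial⟩)
      (fun t ht => ⟨hγ T' (by linarith) t ⟨by linarith [ht.1], by linarith [ht.2]⟩, trivial⟩) ?_
    rw [hγ0 T hT, hγ0 T' (by linarith)]
  refine ⟨fun t => γ (|t| + 1) t, hγ0 _ (by positivity), fun t => ?_⟩
  have hpos : ∀ s : ℝ, 0 < |s| + 1 := fun s => by positivity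
  have hmem : ∀ s : ℝ, s ∈ Ioo (-(|s| + 1)) (|s| + 1) := fun s =>
    ⟨by linarith [neg_abs_le s], by linarith [le_abs_self s]⟩
  have hev : (fun s => γ (|s| + 1) s) =ᶠ[𝓝 t] γ (|t| + 2) := by
    have : ∀ᶠ s in 𝓝 t, |s| < |t| + 1 :=
      continuous_abs.continuousAt.eventually_lt continuousAt_const (by simp)
    filter_upwards [this] with s hs
    exact huniq _ _ (hpos s) (by linarith) (hmem s)
  have hd := hγ (|t| + 2) (by positivity) t
    ⟨by linarith [neg_abs_le t], by linarith [le_abs_self t]⟩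
  have he : γ (|t| + 2) t = γ (|t| + 1) t := (huniq _ _ (hpos t) (by linarith) (hmem t)).symm
  rw [he] at hd
  exact hd.congr_of_eventuallyEq hev

/-- A smooth, bounded, Lipschitz vector field on a Banach space has a smooth global flow. -/
theorem exists_smooth_flow [CompleteSpace F] {f : F → F} (hf : ContDiff ℝ ∞ f) {K L : ℝ≥0}
    (hK : LipschitzWith K f) (hL : ∀ x, ‖f x‖ ≤ L) :
    ∃ Θ : ℝ → F → F, (∀ x, Θ 0 x = x) ∧
      (∀ x t, HasDerivAt (fun s => Θ s x) (f (Θ t x)) t) ∧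
      (∀ s t x, Θ (s + t) x = Θ s (Θ t x)) ∧
      ContDiff ℝ ∞ (fun q : ℝ × F => Θ q.1 q.2) := by
  choose Γ h0 hΓ using exists_global_integralCurve hK hL
  have hgroup : ∀ s t x, Γ x (s + t) = Γ (Γ x t) s := by
    intro s t x
    have := ODE_solution_unique_univ (v := fun _ => f) (s := fun _ => univ) (K := K) (t₀ := 0)
      (f := fun s => Γ x (s + t)) (g := fun s => Γ (Γ x t) s) (fun _ => hK.lipschitzOnWith)
      (fun s => ⟨(hΓ x (s + t)).comp_add_const s t, trivial⟩)
      (fun s => ⟨hΓ _ s, trivial⟩) (by simp [h0])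
    exact congrFun this s
  refine ⟨fun t x => Γ x t, h0, hΓ, hgroup, ?_⟩
  -- any step of length at most `δ` is smooth; longer times are reached by iterating such steps
  set δ : ℝ := 1 / (K + 1) with hδ
  have hδ0 : 0 < δ := by positivity
  have hsmall : ∀ r : ℝ, |r| ≤ δ → |r| * K < 1 := by
    intro r hr
    calc |r| * K ≤ δ * K := by gcongr
      _ < 1 := by rw [hδ, one_div_mul_eq_div, div_lt_one (by positivity)]; linarith
  have hslice : ∀ r : ℝ, |r| ≤ δ → ContDiff ℝ ∞ (fun x => Γ x r) := by
    intro r hr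
    refine contDiff_iff_contDiffAt.2 fun x => ?_
    exact (contDiffAt_flow_of_small hf hK h0 hΓ (hsmall r hr) x).comp x
      (contDiffAt_const.prodMk contDiffAt_id)
  have hiter : ∀ (n : ℕ) (r : ℝ), |r| ≤ δ → ContDiff ℝ ∞ (fun x => Γ x (n * r)) := by
    intro n r hr
    induction n with
    | zero => simpa [h0] using contDiff_fun_id
    | succ n ih =>
      have : (fun x => Γ x ((n + 1 : ℕ) * r)) = (fun x => Γ x r) ∘ fun x => Γ x (n * r) := by
        funext x
        rw [Function.comp_apply, ← hgroup]
        congr 1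
        push_cast
        ring
      rw [this]
      exact (hslice r hr).comp ih
  have htime : ∀ t : ℝ, ContDiff ℝ ∞ (fun x => Γ x t) := by
    intro t
    obtain ⟨n, hn⟩ := exists_nat_gt (|t| / δ)
    have hn0 : (0 : ℝ) < n := lt_of_le_of_lt (by positivity) hn
    have h := hiter n (t / n) (by
      rw [abs_div, abs_of_pos hn0, div_le_iff₀ hn0]
      rw [div_lt_iff₀ hδ0] at hn
      linarith)
    rwa [mul_div_cancel₀ _ hn0.ne'] at h
  refine contDiff_iff_contDiffAt.2 fun q => ?_
  have heq : (fun q : ℝ × F => Γ q.2 q.1) =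
      (fun r : ℝ × F => Γ r.2 r.1) ∘ fun r : ℝ × F => (r.1 - q.1, Γ r.2 q.1) := by
    funext r
    rw [Function.comp_apply, ← hgroup, sub_add_cancel]
  rw [heq]
  refine ContDiffAt.comp q ?_ ?_
  · rw [sub_self]
    exact contDiffAt_flow_of_small hf hK h0 hΓ (by simp) _
  · exact (contDiffAt_fst.sub contDiffAt_const).prodMk
      ((htime q.1).contDiffAt.comp q contDiffAt_snd)

end Flow

/-! ### The ambient vector space of `ℝ²ⁿ × S¹` -/

/-- The vector space `ℝⁿ × ℝⁿ × ℂ`, in which `ℝ²ⁿ × S¹` sits as the hypersurface `|e| = 1`. -/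
abbrev Amb (n : ℕ) : Type := (E n × E n) × ℂ

/-- The inclusion of `ℝ²ⁿ × S¹` into its ambient vector space. -/
def incl {n : ℕ} (p : V n) : Amb n := (p.1, (p.2 : ℂ))

/-- The contact form `dt - α` written in the ambient space. -/
def ambForm {n : ℕ} (p w : Amb n) : ℝ :=
  (conj p.2 * w.2).im / (2 * Real.pi) - (⟪p.1.2, w.1.1⟫_ℝ - ⟪p.1.1, w.1.2⟫_ℝ) / 2

attribute [local instance] finrank_real_complex_fact'

variable {n : ℕ}

lemma incl_injective : Function.Injective (incl (n := n)) := by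
  rintro ⟨a, b⟩ ⟨c, d⟩ h
  simp only [incl, Prod.mk.injEq] at h
  exact Prod.ext h.1 (Subtype.ext h.2)

lemma norm_incl_snd (p : V n) : ‖(incl p).2‖ = 1 := p.2.norm_coe

lemma contMDiff_incl : ContMDiff (model n) 𝓘(ℝ, Amb n) ∞ (incl (n := n)) := by
  have h1 : ContMDiff (model n) 𝓘(ℝ, E n × E n) ∞ (fun p : V n => p.1) := contMDiff_fst
  have h2 : ContMDiff (model n) 𝓘(ℝ, ℂ) ∞ (fun p : V n => (p.2 : ℂ)) :=
    (contMDiff_coe_sphere (E := ℂ) (n := 1)).comp contMDiff_snd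
  exact h1.prodMk_space h2

lemma continuous_incl : Continuous (incl (n := n)) := contMDiff_incl.continuous

lemma mdifferentiableAt_incl (p : V n) :
    MDifferentiableAt (model n) 𝓘(ℝ, Amb n) (incl (n := n)) p :=
  contMDiff_incl.mdifferentiable (by simp) p

lemma mfderiv_comp_incl {G : Type} [NormedAddCommGroup G] [NormedSpace ℝ G] {f : Amb n → G}
    (p : V n) (hf : DifferentiableAt ℝ f (incl p)) (v : TangentSpace (model n) p) :
    mfderiv (model n) 𝓘(ℝ, G) (f ∘ incl) p v =
      fderiv ℝ f (incl p) (mfderiv (model n) 𝓘(ℝ, Amb n) incl p v) := by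
  rw [mfderiv_comp p hf.mdifferentiableAt (mdifferentiableAt_incl p), mfderiv_eq_fderiv]
  rfl

lemma contactForm_eq_ambForm (p : V n) (v : TangentSpace (model n) p) :
    contactForm p v = ambForm (incl p) (mfderiv (model n) 𝓘(ℝ, Amb n) incl p v) := by
  have key : ∀ {G : Type} [NormedAddCommGroup G] [NormedSpace ℝ G] (L : Amb n →L[ℝ] G),
      mfderiv (model n) 𝓘(ℝ, G) (L ∘ incl) p v
        = L (mfderiv (model n) 𝓘(ℝ, Amb n) incl p v) := by
    intro G _ _ L
    rw [mfderiv_comp_incl p L.differentiableAt, L.fderiv]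
  have hx : dx p v = (mfderiv (model n) 𝓘(ℝ, Amb n) incl p v).1.1 :=
    key ((ContinuousLinearMap.fst ℝ (E n) (E n)).comp (ContinuousLinearMap.fst ℝ _ ℂ))
  have hy : dy p v = (mfderiv (model n) 𝓘(ℝ, Amb n) incl p v).1.2 :=
    key ((ContinuousLinearMap.snd ℝ (E n) (E n)).comp (ContinuousLinearMap.fst ℝ _ ℂ))
  have he : de p v = (mfderiv (model n) 𝓘(ℝ, Amb n) incl p v).2 :=
    key (ContinuousLinearMap.snd ℝ (E n × E n) ℂ)
  rw [contactForm, dt, liouvilleForm, hx, hy, he]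
  rfl

/-- Vectors tangent to `ℝ²ⁿ × S¹` satisfy the derivative of the equation `|e|² = 1`. -/
lemma re_conj_mul_mfderiv_incl (p : V n) (v : TangentSpace (model n) p) :
    (conj (incl p).2 * (mfderiv (model n) 𝓘(ℝ, Amb n) incl p v).2).re = 0 := by
  have hf : HasFDerivAt (fun q : Amb n => ⟪q.2, q.2⟫_ℝ)
      _ (incl p) := (hasFDerivAt_snd.inner ℝ hasFDerivAt_snd)
  have h1 := mfderiv_comp_incl p hf.differentiableAt v
  have h2 : (fun q : Amb n => ⟪q.2, q.2⟫_ℝ) ∘ incl = fun _ : V n => (1 : ℝ) := by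
    funext q
    simp only [Function.comp_apply, real_inner_self_eq_norm_sq, norm_incl_snd]
    norm_num
  rw [h2, mfderiv_const, hf.fderiv] at h1
  have h3 : (0 : ℝ) = 2 * ⟪(incl p).2, (mfderiv (model n) 𝓘(ℝ, Amb n) incl p v).2⟫_ℝ := by
    refine h1.trans ?_
    rw [two_mul]
    nth_rewrite 2 [real_inner_comm]
    rfl
  rw [Complex.inner] at h3
  rw [mul_comm]
  linarith

/-- A smooth map into the ambient space with values in `|e| = 1`, as a map into `ℝ²ⁿ × S¹`. -/
def toV {X : Type*} (f : X → Amb n) (hf : ∀ x, ‖(f x).2‖ = 1) (x : X) : V n :=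
  ((f x).1, ⟨(f x).2, mem_sphere_zero_iff_norm.2 (hf x)⟩)

@[simp] lemma incl_toV {X : Type*} (f : X → Amb n) (hf : ∀ x, ‖(f x).2‖ = 1) (x : X) :
    incl (toV f hf x) = f x := rfl

lemma contMDiff_toV {H EM M : Type*} [NormedAddCommGroup EM] [NormedSpace ℝ EM]
    [TopologicalSpace H] {J : ModelWithCorners ℝ EM H} [TopologicalSpace M] [ChartedSpace H M]
    [IsManifold J ∞ M] {f : M → Amb n} (hf : ∀ x, ‖(f x).2‖ = 1)
    (hs : ContMDiff J 𝓘(ℝ, Amb n) ∞ f) :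
    ContMDiff J (model n) ∞ (toV f hf) := by
  have h1 : ContMDiff J 𝓘(ℝ, E n × E n) ∞ (fun x => (f x).1) :=
    contDiff_fst.contMDiff.comp hs
  have h2 : ContMDiff J 𝓘(ℝ, ℂ) ∞ (fun x => (f x).2) := contDiff_snd.contMDiff.comp hs
  have h3 : ContMDiff J (𝓡 1) ∞
      (Set.codRestrict (fun x => (f x).2) (Metric.sphere (0 : ℂ) 1)
        fun x => mem_sphere_zero_iff_norm.2 (hf x)) :=
    ContMDiff.codRestrict_sphere h2 _
  exact h1.prodMk h3

/-! ### Contact Hamiltonians -/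

/-- The gradient of `K` in the variable `x`. -/
def gradX (K : Amb n → ℝ) (p : Amb n) : E n :=
  WithLp.toLp 2 fun i => fderiv ℝ K p ((EuclideanSpace.single i 1, 0), 0)

/-- The gradient of `K` in the variable `y`. -/
def gradY (K : Amb n → ℝ) (p : Amb n) : E n :=
  WithLp.toLp 2 fun i => fderiv ℝ K p ((0, EuclideanSpace.single i 1), 0)

/-- The derivative of `K` in the angular coordinate `t`, where `e = exp (2πit)`. -/
def angDeriv (K : Amb n → ℝ) (p : Amb n) : ℝ :=
  fderiv ℝ K p (0, (2 * Real.pi : ℝ) * Complex.I * p.2)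

/-- The angular speed `K - (x K_x + y K_y) / 2` of the contact vector field of `K`. -/
def angSpeed (K : Amb n → ℝ) (p : Amb n) : ℝ :=
  K p - (⟪p.1.1, gradX K p⟫_ℝ + ⟪p.1.2, gradY K p⟫_ℝ) / 2

/-- The contact vector field `X` of the contact Hamiltonian `K`: the field with
`(dt - α)(X) = K` whose flow preserves `ker (dt - α)`. -/
def contactField (K : Amb n → ℝ) (p : Amb n) : Amb n :=
  ((-gradY K p + (angDeriv K p / 2) • p.1.1, gradX K p + (angDeriv K p / 2) • p.1.2),
    (2 * Real.pi * angSpeed K p : ℝ) * Complex.I * p.2)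

lemma inner_gradX (K : Amb n → ℝ) (p : Amb n) (w : E n) :
    ⟪gradX K p, w⟫_ℝ = fderiv ℝ K p ((w, 0), 0) := by
  let L : E n →L[ℝ] ℝ := (fderiv ℝ K p).comp
    ((ContinuousLinearMap.inl ℝ (E n × E n) ℂ).comp (ContinuousLinearMap.inl ℝ (E n) (E n)))
  have hw : w = ∑ i, w i • EuclideanSpace.single i (1 : ℝ) := by
    ext j; simp [Pi.single_apply]
  have h : fderiv ℝ K p ((w, 0), 0) = L w := rfl
  rw [h]
  conv_rhs => rw [hw, map_sum]
  simp only [gradX, PiLp.inner_apply, map_smul, smul_eq_mul]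
  refine Finset.sum_congr rfl fun i _ => ?_
  simp [L]

lemma inner_gradY (K : Amb n → ℝ) (p : Amb n) (w : E n) :
    ⟪gradY K p, w⟫_ℝ = fderiv ℝ K p ((0, w), 0) := by
  let L : E n →L[ℝ] ℝ := (fderiv ℝ K p).comp
    ((ContinuousLinearMap.inl ℝ (E n × E n) ℂ).comp (ContinuousLinearMap.inr ℝ (E n) (E n)))
  have hw : w = ∑ i, w i • EuclideanSpace.single i (1 : ℝ) := by
    ext j; simp [Pi.single_apply]
  have h : fderiv ℝ K p ((0, w), 0) = L w := rfl
  rw [h]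
  conv_rhs => rw [hw, map_sum]
  simp only [gradY, PiLp.inner_apply, map_smul, smul_eq_mul]
  refine Finset.sum_congr rfl fun i _ => ?_
  simp [L]

/-- The differential of `K` on vectors tangent to `|e| = 1`. -/
lemma fderiv_apply_of_tangent (K : Amb n → ℝ) {p w : Amb n} (hp : ‖p.2‖ = 1)
    (hw : (conj p.2 * w.2).re = 0) :
    fderiv ℝ K p w = ⟪gradX K p, w.1.1⟫_ℝ + ⟪gradY K p, w.1.2⟫_ℝ
      + angDeriv K p * ((conj p.2 * w.2).im / (2 * Real.pi)) := by
  set c : ℝ := (conj p.2 * w.2).im / (2 * Real.pi) with hc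
  have hpi := Real.pi_ne_zero
  have h1 : conj p.2 * w.2 = ((2 * Real.pi * c : ℝ) : ℂ) * Complex.I := by
    apply Complex.ext
    · simpa using hw
    · simp only [Complex.mul_I_im, Complex.ofReal_re, hc]
      field_simp
  have h2 : w.2 = c • ((2 * Real.pi : ℝ) * Complex.I * p.2) := by
    have h3 : p.2 * conj p.2 = 1 := by
      rw [Complex.mul_conj, Complex.normSq_eq_norm_sq, hp]; norm_num
    calc w.2 = (p.2 * conj p.2) * w.2 := by rw [h3, one_mul]
      _ = p.2 * (conj p.2 * w.2) := by ring
      _ = _ := by rw [h1, Complex.real_smul]; push_cast; ring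
  have h4 : w = ((w.1.1, 0), 0) + ((0, w.1.2), 0)
      + c • (0, (2 * Real.pi : ℝ) * Complex.I * p.2) := by
    refine Prod.ext (Prod.ext ?_ ?_) ?_
    · simp
    · simp
    · simpa using h2
  rw [inner_gradX, inner_gradY, angDeriv]
  conv_lhs => rw [h4, map_add, map_add, map_smul]
  rw [smul_eq_mul]
  ring

lemma ambForm_contactField (K : Amb n → ℝ) (p : Amb n) :
    ambForm p (contactField K p) = K p + (‖p.2‖ ^ 2 - 1) * angSpeed K p := by
  have h1 : (conj p.2 * (contactField K p).2).im = 2 * Real.pi * angSpeed K p * ‖p.2‖ ^ 2 := by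
    have : conj p.2 * (contactField K p).2
        = ((2 * Real.pi * angSpeed K p * ‖p.2‖ ^ 2 : ℝ) : ℂ) * Complex.I := by
      rw [← Complex.normSq_eq_norm_sq]
      simp only [contactField]
      push_cast
      rw [Complex.normSq_eq_conj_mul_self]
      ring
    rw [this, Complex.mul_I_im, Complex.ofReal_re]
  rw [ambForm, h1]
  simp only [contactField, inner_add_right, inner_neg_right, inner_smul_right]
  rw [real_inner_comm p.1.1 p.1.2]
  have hpi := Real.pi_ne_zero
  field_simp
  rw [angSpeed]
  ring

lemma contDiff_fderiv_family {K : ℝ → Amb n → ℝ} (hK : ContDiff ℝ ∞ (Function.uncurry K))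
    {w : ℝ × Amb n → Amb n} (hw : ContDiff ℝ ∞ w) :
    ContDiff ℝ ∞ (fun q : ℝ × Amb n => fderiv ℝ (K q.1) q.2 (w q)) := by
  have h : ContDiff ℝ ∞ (fun q : ℝ × Amb n => fderiv ℝ (K q.1) q.2) := by
    refine ContDiff.fderiv (m := ∞) (f := fun (q : ℝ × Amb n) (p : Amb n) => K q.1 p)
      (hK.comp ((contDiff_fst.comp contDiff_fst).prodMk contDiff_snd)) contDiff_snd (by simp)
  exact h.clm_apply hw

lemma contDiff_gradX {K : ℝ → Amb n → ℝ} (hK : ContDiff ℝ ∞ (Function.uncurry K)) :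
    ContDiff ℝ ∞ (fun q : ℝ × Amb n => gradX (K q.1) q.2) :=
  contDiff_euclidean.2 fun _ => contDiff_fderiv_family hK contDiff_const

lemma contDiff_gradY {K : ℝ → Amb n → ℝ} (hK : ContDiff ℝ ∞ (Function.uncurry K)) :
    ContDiff ℝ ∞ (fun q : ℝ × Amb n => gradY (K q.1) q.2) :=
  contDiff_euclidean.2 fun _ => contDiff_fderiv_family hK contDiff_const

lemma contDiff_angDeriv {K : ℝ → Amb n → ℝ} (hK : ContDiff ℝ ∞ (Function.uncurry K)) :
    ContDiff ℝ ∞ (fun q : ℝ × Amb n => angDeriv (K q.1) q.2) :=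
  contDiff_fderiv_family hK (contDiff_const.prodMk
    (contDiff_const.mul (contDiff_snd.comp contDiff_snd)))

lemma contDiff_angSpeed {K : ℝ → Amb n → ℝ} (hK : ContDiff ℝ ∞ (Function.uncurry K)) :
    ContDiff ℝ ∞ (fun q : ℝ × Amb n => angSpeed (K q.1) q.2) := by
  have h1 : ContDiff ℝ ∞ (fun q : ℝ × Amb n => q.2.1.1) :=
    contDiff_fst.comp (contDiff_fst.comp contDiff_snd)
  have h2 : ContDiff ℝ ∞ (fun q : ℝ × Amb n => q.2.1.2) :=
    contDiff_snd.comp (contDiff_fst.comp contDiff_snd)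
  exact hK.sub (((h1.inner ℝ (contDiff_gradX hK)).add (h2.inner ℝ (contDiff_gradY hK))).div_const 2)

lemma contDiff_contactField {K : ℝ → Amb n → ℝ} (hK : ContDiff ℝ ∞ (Function.uncurry K)) :
    ContDiff ℝ ∞ (fun q : ℝ × Amb n => contactField (K q.1) q.2) := by
  have h1 : ContDiff ℝ ∞ (fun q : ℝ × Amb n => q.2.1.1) :=
    contDiff_fst.comp (contDiff_fst.comp contDiff_snd)
  have h2 : ContDiff ℝ ∞ (fun q : ℝ × Amb n => q.2.1.2) :=
    contDiff_snd.comp (contDiff_fst.comp contDiff_snd)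
  have h3 := (contDiff_angDeriv hK).div_const 2
  have h4 : ContDiff ℝ ∞
      (fun q : ℝ × Amb n => ((2 * Real.pi * angSpeed (K q.1) q.2 : ℝ) : ℂ)) :=
    Complex.ofRealCLM.contDiff.comp (contDiff_const.mul (contDiff_angSpeed hK))
  exact (((contDiff_gradY hK).neg.add (h3.smul h1)).prodMk
    ((contDiff_gradX hK).add (h3.smul h2))).prodMk
    ((h4.mul contDiff_const).mul (contDiff_snd.comp contDiff_snd))

/-- The form `ambForm`, which is bilinear in the point and the vector. -/
lemma hasFDerivAt_ambForm {G : Type} [NormedAddCommGroup G] [NormedSpace ℝ G]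
    {f g : G → Amb n} {f' g' : G →L[ℝ] Amb n} {x : G} (hf : HasFDerivAt f f' x)
    (hg : HasFDerivAt g g' x) : ∃ L : G →L[ℝ] ℝ, HasFDerivAt (fun y => ambForm (f y) (g y)) L x ∧
      ∀ v, L v = ambForm (f' v) (g x) + ambForm (f x) (g' v) := by
  have hfx := hf.fst.fst
  have hfy := hf.fst.snd
  have hgx := hg.fst.fst
  have hgy := hg.fst.snd
  have hfe : HasFDerivAt (fun y => conj (f y).2) _ x :=
    Complex.conjCLE.toContinuousLinearMap.hasFDerivAt.comp x hf.snd
  have him := (Complex.imCLM.hasFDerivAt.comp x (hfe.mul hg.snd)).mul_const (2 * Real.pi)⁻¹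
  have hin := ((hfy.inner ℝ hgx).sub (hfx.inner ℝ hgy)).mul_const (2 : ℝ)⁻¹
  refine ⟨_, (him.sub hin).congr_of_eventuallyEq (.of_forall fun y => ?_), fun v => ?_⟩
  · simp [ambForm, div_eq_mul_inv]
  · simp [ambForm, div_eq_mul_inv]
    ring

lemma ambForm_swap (p w : Amb n) : ambForm w p = -ambForm p w := by
  simp only [ambForm, Complex.mul_im, Complex.conj_re, Complex.conj_im]
  rw [real_inner_comm p.1.1 w.1.2, real_inner_comm p.1.2 w.1.1]
  ring

/-- Along the flow of the contact field of `K`, the contact form evaluated on a transported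
tangent vector `w` is multiplied by a factor whose logarithmic derivative is `K_t`. -/
lemma hasDerivAt_ambForm {K : Amb n → ℝ} (hK : ContDiff ℝ ∞ K) {p w : ℝ → Amb n} {s : ℝ}
    (hp : HasDerivAt p (contactField K (p s)) s)
    (hw : HasDerivAt w (fderiv ℝ (contactField K) (p s) (w s)) s)
    (hunit : ‖(p s).2‖ = 1) (htan : (conj (p s).2 * (w s).2).re = 0) :
    HasDerivAt (fun s => ambForm (p s) (w s)) (angDeriv K (p s) * ambForm (p s) (w s)) s := by
  have hKu : ContDiff ℝ ∞ (Function.uncurry fun _ : ℝ => K) := hK.comp contDiff_snd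
  have hpair : ContDiff ℝ ∞ (fun q : Amb n => ((0 : ℝ), q)) := contDiff_const.prodMk contDiff_id
  have hX : Differentiable ℝ (contactField K) :=
    ((contDiff_contactField hKu).comp hpair).differentiable (by simp)
  have hc : Differentiable ℝ (angSpeed K) :=
    ((contDiff_angSpeed hKu).comp hpair).differentiable (by simp)
  obtain ⟨L, hL, hL'⟩ := hasFDerivAt_ambForm hp.hasFDerivAt hw.hasFDerivAt
  obtain ⟨M, hM, hM'⟩ := hasFDerivAt_ambForm (hasFDerivAt_id (p s)) (hX (p s)).hasFDerivAt
  -- differentiate the identity `(dt - α)(X) = K + (|e|² - 1) c` in the direction `w`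
  have hsq : HasFDerivAt (fun q : Amb n => ‖q.2‖ ^ 2 - 1) _ (p s) :=
    (HasFDerivAt.norm_sq hasFDerivAt_snd).sub_const 1
  have hR := ((hK.differentiable (by simp)) (p s)).hasFDerivAt.add (hsq.mul (hc (p s)).hasFDerivAt)
  have hMR := hM.unique (hR.congr_of_eventuallyEq
    (.of_forall fun q => ambForm_contactField K q))
  have h1 := congrArg (fun T : Amb n →L[ℝ] ℝ => T (w s)) hMR
  have htan' : ⟪(p s).2, (w s).2⟫_ℝ = 0 := by rw [Complex.inner, mul_comm]; exact htan
  have h2 : ambForm (w s) (contactField K (p s))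
      + ambForm (p s) (fderiv ℝ (contactField K) (p s) (w s)) = fderiv ℝ K (p s) (w s) := by
    have := hM' (w s)
    simp only [id_eq, ContinuousLinearMap.id_apply] at this
    rw [← this]
    refine h1.trans ?_
    simp [hunit, htan']
  have h3 := hL.hasDerivAt
  have h4 := hL' 1
  simp only [ContinuousLinearMap.toSpanSingleton_apply, one_smul] at h4
  have h5 : (conj (contactField K (p s)).2 * (w s).2).im = 0 := by
    simp only [contactField, map_mul, Complex.conj_ofReal, Complex.conj_I]
    have : ((2 * Real.pi * angSpeed K (p s) : ℝ) : ℂ) * -Complex.I * conj (p s).2 * (w s).2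
        = -((2 * Real.pi * angSpeed K (p s) : ℝ) : ℂ) * (conj (p s).2 * (w s).2 * Complex.I) := by
      ring
    rw [this, ← Complex.ofReal_neg, Complex.im_ofReal_mul, Complex.mul_I_im, htan, mul_zero]
  have h6 := fderiv_apply_of_tangent K hunit htan
  convert h3 using 1
  rw [h4]
  rw [ambForm_swap (contactField K (p s)) (w s)] at h2
  have h7 : ambForm (contactField K (p s)) (w s)
      = -(⟪gradX K (p s) + (angDeriv K (p s) / 2) • (p s).1.2, (w s).1.1⟫_ℝ
        - ⟪-gradY K (p s) + (angDeriv K (p s) / 2) • (p s).1.1, (w s).1.2⟫_ℝ) / 2 := by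
    rw [ambForm, h5]
    simp only [contactField]
    ring
  have h8 : ambForm (p s) (fderiv ℝ (contactField K) (p s) (w s))
      = fderiv ℝ K (p s) (w s) + ambForm (contactField K (p s)) (w s) := by linarith
  rw [h8, h7, h6, ambForm]
  simp only [inner_add_left, inner_neg_left, inner_smul_left, RCLike.conj_to_real]
  ring

/-- A solution of a scalar linear equation `h' = m h` vanishes at all times or at none. -/
lemma eq_zero_iff_of_hasDerivAt_mul {h m : ℝ → ℝ} (hm : Continuous m)
    (hh : ∀ s, HasDerivAt h (m s * h s) s) (s : ℝ) : h s = 0 ↔ h 0 = 0 := by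
  have hd : ∀ s, HasDerivAt (fun s => h s * Real.exp (-∫ τ in (0 : ℝ)..s, m τ)) 0 s := by
    intro s
    have h1 := intervalIntegral.integral_hasDerivAt_right (hm.intervalIntegrable 0 s)
      (hm.stronglyMeasurableAtFilter _ _) hm.continuousAt
    exact ((hh s).mul h1.neg.exp).congr_deriv (by simp only [Pi.neg_apply]; ring)
  have hconst := is_const_of_deriv_eq_zero (fun s => (hd s).differentiableAt)
    (fun s => (hd s).deriv) s 0
  simp only [intervalIntegral.integral_same, neg_zero, Real.exp_zero, mul_one] at hconst
  rw [← hconst]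
  simp [Real.exp_ne_zero]

/-- The flow of the contact field of a compactly supported time-dependent contact Hamiltonian
`K`, in the ambient space: `T s p` is the position at time `s` of the trajectory starting at `p` at
time `0`, and `T' s` is the inverse of `T s`. -/
lemma exists_ambient_flow {K : ℝ → Amb n → ℝ} (hK : ContDiff ℝ ∞ (Function.uncurry K))
    (hc : HasCompactSupport (Function.uncurry K)) :
    ∃ T T' : ℝ → Amb n → Amb n,
      ContDiff ℝ ∞ (Function.uncurry T) ∧ (∀ s, ContDiff ℝ ∞ (T' s)) ∧
      (∀ p, T 0 p = p) ∧
      (∀ p s, HasDerivAt (fun s => T s p) (contactField (K s) (T s p)) s) ∧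
      (∀ s p, T' s (T s p) = p) ∧ (∀ s p, T s (T' s p) = p) ∧
      (∀ p, (∀ s, (s, p) ∉ tsupport (Function.uncurry K)) → ∀ s, T s p = p) ∧
      (∀ s p, ‖(T s p).2‖ = ‖p.2‖) ∧ (∀ s p, ‖(T' s p).2‖ = ‖p.2‖) := by
  set Y : ℝ × Amb n → Amb n := fun q => contactField (K q.1) q.2 with hY
  have hYs : ContDiff ℝ ∞ Y := contDiff_contactField hK
  have hY0 : ∀ q, q ∉ tsupport (Function.uncurry K) → Y q = 0 := by
    intro q hq
    have h1 : Function.uncurry K =ᶠ[𝓝 q] 0 := notMem_tsupport_iff_eventuallyEq.1 hq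
    have h2 : K q.1 =ᶠ[𝓝 q.2] fun _ => 0 :=
      (Continuous.prodMk_right q.1).tendsto q.2 |>.eventually h1
    have h3 : fderiv ℝ (K q.1) q.2 = 0 := by rw [h2.fderiv_eq]; simp
    have h4 : gradX (K q.1) q.2 = 0 := by ext; simp [gradX, h3]
    have h5 : gradY (K q.1) q.2 = 0 := by ext; simp [gradY, h3]
    have h6 : K q.1 q.2 = 0 := h2.self_of_nhds
    simp [hY, contactField, h4, h5, angSpeed, angDeriv, h3, h6]
  have hYc : HasCompactSupport Y := HasCompactSupport.intro hc hY0
  obtain ⟨C, hC⟩ := hYs.lipschitzWith_of_hasCompactSupport hYc (by simp)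
  obtain ⟨B, hB⟩ := hYs.continuous.bounded_above_of_compact_support hYc
  let Z : ℝ × Amb n → ℝ × Amb n := fun q => (1, Y q)
  have hZs : ContDiff ℝ ∞ Z := contDiff_const.prodMk hYs
  have hZl : LipschitzWith (max 0 C) Z := (LipschitzWith.const 1).prodMk hC
  have hZb : ∀ q, ‖Z q‖ ≤ (max 1 B).toNNReal := by
    intro q
    rw [Real.coe_toNNReal _ (by positivity), Prod.norm_def]
    exact max_le_max (by simp [Z]) (hB q)
  obtain ⟨Θ, h0, hd, hg, hs⟩ := exists_smooth_flow hZs hZl hZb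
  have hd1 : ∀ q t, HasDerivAt (fun s => (Θ s q).1) 1 t := fun q t =>
    (hd q t).fst
  have hd2 : ∀ q t, HasDerivAt (fun s => (Θ s q).2) (Y (Θ t q)) t := fun q t =>
    (hd q t).snd
  have htime : ∀ q t, (Θ t q).1 = t + q.1 := by
    intro q t
    have := is_const_of_deriv_eq_zero (f := fun s => (Θ s q).1 - s)
      (fun s => ((hd1 q s).sub (hasDerivAt_id s)).differentiableAt)
      (fun s => ((hd1 q s).sub (hasDerivAt_id s)).deriv.trans (sub_self 1)) t 0
    simp only [h0, sub_zero] at this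
    linarith
  have hnorm : ∀ q t, ‖(Θ t q).2.2‖ = ‖q.2.2‖ := by
    intro q t
    have hz : ∀ s, HasDerivAt (fun s => ‖(Θ s q).2.2‖ ^ 2) 0 s := by
      intro s
      have h1 := HasDerivAt.norm_sq ((hd2 q s).snd)
      convert h1 using 1
      simp only [hY, contactField]
      rw [Complex.inner, show ∀ a b : ℂ, a * Complex.I * b * conj b
          = a * Complex.I * (b * conj b) from fun a b => by ring, Complex.mul_conj,
        mul_right_comm, ← Complex.ofReal_mul, Complex.re_ofReal_mul]
      simp
    have := is_const_of_deriv_eq_zero (fun s => (hz s).differentiableAt) (fun s => (hz s).deriv) t 0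
    simp only [h0] at this
    exact (sq_eq_sq₀ (norm_nonneg _) (norm_nonneg _)).1 this
  have hpair : ∀ s (p : Amb n), Θ s (0, p) = (s, (Θ s (0, p)).2) := fun s p =>
    Prod.ext (by simpa using htime (0, p) s) rfl
  have hpair' : ∀ s (p : Amb n), Θ (-s) (s, p) = (0, (Θ (-s) (s, p)).2) := fun s p =>
    Prod.ext (by simpa using htime (s, p) (-s)) rfl
  refine ⟨fun s p => (Θ s (0, p)).2, fun s p => (Θ (-s) (s, p)).2, ?_, ?_, ?_, ?_, ?_, ?_, ?_,
    ?_, ?_⟩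
  · exact contDiff_snd.comp (hs.comp (contDiff_fst.prodMk (contDiff_const.prodMk contDiff_snd)))
  · intro s
    exact contDiff_snd.comp (hs.comp (contDiff_const.prodMk (contDiff_const.prodMk contDiff_id)))
  · intro p
    simp [h0]
  · intro p s
    have h1 := hd2 (0, p) s
    rw [hpair s p] at h1
    exact h1
  · intro s p
    show (Θ (-s) (s, (Θ s (0, p)).2)).2 = p
    rw [← hpair, ← hg, neg_add_cancel, h0]
  · intro s p
    show (Θ s (0, (Θ (-s) (s, p)).2)).2 = p
    rw [← hpair', ← hg, add_neg_cancel, h0]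
  · intro p hp s
    have h1 : ∀ t, HasDerivAt (fun t : ℝ => (t, p)) (Z (t, p)) t := by
      intro t
      have : Z (t, p) = (1, 0) := by simp only [Z]; rw [hY0 _ (hp t)]
      rw [this]
      exact (hasDerivAt_id t).prodMk (hasDerivAt_const t p)
    have h2 := ODE_solution_unique_univ (v := fun _ => Z) (s := fun _ => univ) (t₀ := 0)
      (f := fun t => Θ t (0, p)) (g := fun t => (t, p)) (fun _ => hZl.lipschitzOnWith)
      (fun t => ⟨hd (0, p) t, trivial⟩) (fun t => ⟨h1 t, trivial⟩) (by simp [h0])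
    have h3 : Θ s (0, p) = (s, p) := congrFun h2 s
    exact congrArg Prod.snd h3
  · intro s p
    exact hnorm (0, p) s
  · intro s p
    exact hnorm (s, p) (-s)

/-- The transport of a tangent vector by a smooth flow solves the linearised equation. -/
lemma hasDerivAt_fderiv_flow {T : ℝ → Amb n → Amb n} (hT : ContDiff ℝ ∞ (Function.uncurry T))
    {Y : ℝ × Amb n → Amb n} (hY : ContDiff ℝ ∞ Y)
    (hd : ∀ p s, HasDerivAt (fun s => T s p) (Y (s, T s p)) s) (p v : Amb n) (s : ℝ) :
    HasDerivAt (fun s => fderiv ℝ (T s) p v)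
      (fderiv ℝ (fun q => Y (s, q)) (T s p) (fderiv ℝ (T s) p v)) s := by
  set U := Function.uncurry T with hU
  have hUd : Differentiable ℝ U := hT.differentiable (by simp)
  have hslice : ∀ s, HasFDerivAt (T s) ((fderiv ℝ U (s, p)).comp (.inr ℝ ℝ (Amb n))) p := fun s =>
    HasFDerivAt.comp p (hUd (s, p)).hasFDerivAt (hasFDerivAt_prodMk_right s p)
  have hv : ∀ s, fderiv ℝ (T s) p v = fderiv ℝ U (s, p) (0, v) := by
    intro s
    rw [(hslice s).fderiv]
    simp
  have hU1 : ∀ r : ℝ × Amb n, fderiv ℝ U r (1, 0) = Y (r.1, U r) := by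
    intro r
    have h1 : HasDerivAt (fun s => T s r.2) (fderiv ℝ U (r.1, r.2) (1, 0)) r.1 :=
      (hUd (r.1, r.2)).hasFDerivAt.comp_hasDerivAt (f := fun s => (s, r.2)) r.1
        ((hasDerivAt_id r.1).prodMk (hasDerivAt_const r.1 r.2))
    exact h1.unique (hd r.2 r.1)
  have hU2 : ContDiff ℝ ∞ (fderiv ℝ U) := hT.fderiv_right (by simp)
  have hU2d := (hU2.differentiable (by simp) (s, p)).hasFDerivAt
  have hsymm : fderiv ℝ (fderiv ℝ U) (s, p) (1, 0) (0, v)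
      = fderiv ℝ (fderiv ℝ U) (s, p) (0, v) (1, 0) :=
    hT.contDiffAt.isSymmSndFDerivAt (by
      rw [minSmoothness_of_isRCLikeNormedField]; exact WithTop.coe_le_coe.2 le_top) _ _
  have h1 : HasDerivAt (fun s => fderiv ℝ U (s, p) (0, v))
      (fderiv ℝ (fderiv ℝ U) (s, p) (1, 0) (0, v)) s := by
    have := hU2d.comp_hasDerivAt s ((hasDerivAt_id s).prodMk (hasDerivAt_const s p))
    exact this.clm_apply (hasDerivAt_const s ((0 : ℝ), v)) |>.congr_deriv (by simp)
  have h2 : HasDerivAt (fun ε : ℝ => fderiv ℝ U (s, p + ε • v) (1, 0))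
      (fderiv ℝ (fderiv ℝ U) (s, p) (0, v) (1, 0)) 0 := by
    have hl : HasDerivAt (fun ε : ℝ => (s, p + ε • v)) ((0 : ℝ), v) 0 :=
      (hasDerivAt_const _ _).prodMk (by
        simpa using ((hasDerivAt_id (0 : ℝ)).smul_const v).const_add p)
    have := HasFDerivAt.comp_hasDerivAt (0 : ℝ) (by simpa using hU2d) hl
    exact this.clm_apply (hasDerivAt_const (0 : ℝ) ((1 : ℝ), (0 : Amb n))) |>.congr_deriv (by simp)
  have h3 : HasDerivAt (fun ε : ℝ => Y (s, T s (p + ε • v)))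
      (fderiv ℝ (fun q => Y (s, q)) (T s p) (fderiv ℝ (T s) p v)) 0 := by
    have hl : HasDerivAt (fun ε : ℝ => p + ε • v) v 0 := by
      simpa using ((hasDerivAt_id (0 : ℝ)).smul_const v).const_add p
    have hTs : HasFDerivAt (T s) (fderiv ℝ (T s) p) (p + (0 : ℝ) • v) := by
      simpa using (hslice s).differentiableAt.hasFDerivAt
    have hYd : HasFDerivAt (fun q => Y (s, q)) (fderiv ℝ (fun q => Y (s, q)) (T s p))
        (T s (p + (0 : ℝ) • v)) := by
      have : Differentiable ℝ (fun q => Y (s, q)) :=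
        (hY.comp (contDiff_const.prodMk contDiff_id)).differentiable (by simp)
      simpa using (this (T s p)).hasFDerivAt
    exact hYd.comp_hasDerivAt (0 : ℝ) (hTs.comp_hasDerivAt (0 : ℝ) hl)
  have h4 : (fun ε : ℝ => fderiv ℝ U (s, p + ε • v) (1, 0))
      = fun ε : ℝ => Y (s, T s (p + ε • v)) := by
    funext ε
    rw [hU1]
    rfl
  rw [h4] at h2
  have h5 := h2.unique h3
  rw [hsymm, h5] at h1
  exact h1.congr_of_eventuallyEq (.of_forall hv)

/-- A compactly supported time-dependent contact Hamiltonian generates a contact isotopy of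
`ℝ²ⁿ × S¹`. -/
theorem exists_contactIsotopy {K : ℝ → Amb n → ℝ} (hK : ContDiff ℝ ∞ (Function.uncurry K))
    (hc : HasCompactSupport (Function.uncurry K)) :
    ∃ φ : ℝ → V n ≃ₘ^∞⟮model n, model n⟯ V n, IsContactIsotopy φ ∧
      (∀ p s, HasDerivAt (fun s => incl (φ s p)) (contactField (K s) (incl (φ s p))) s) ∧
      (∀ p, (∀ s, (s, incl p) ∉ tsupport (Function.uncurry K)) → ∀ s, φ s p = p) := by
  obtain ⟨T, T', hT, hT', h0, hd, hl, hr, hsupp, hn1, hn2⟩ := exists_ambient_flow hK hc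
  have hTs : ∀ s, ContDiff ℝ ∞ (T s) := fun s => hT.comp (contDiff_const.prodMk contDiff_id)
  have hu1 : ∀ s (p : V n), ‖(T s (incl p)).2‖ = 1 := fun s p => by rw [hn1, norm_incl_snd]
  have hu2 : ∀ s (p : V n), ‖(T' s (incl p)).2‖ = 1 := fun s p => by rw [hn2, norm_incl_snd]
  let φ : ℝ → V n ≃ₘ^∞⟮model n, model n⟯ V n := fun s =>
    { toFun := toV (fun p => T s (incl p)) (hu1 s)
      invFun := toV (fun p => T' s (incl p)) (hu2 s)
      left_inv := fun p => incl_injective (by simp [hl])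
      right_inv := fun p => incl_injective (by simp [hr])
      contMDiff_toFun := contMDiff_toV (hu1 s) ((hTs s).contMDiff.comp contMDiff_incl)
      contMDiff_invFun := contMDiff_toV (hu2 s) ((hT' s).contMDiff.comp contMDiff_incl) }
  have hφ : ∀ s p, incl (φ s p) = T s (incl p) := fun s p => rfl
  refine ⟨φ, ⟨?_, ?_, ?_⟩, ?_, ?_⟩
  · refine ContMDiff.contMDiffOn ?_
    have h1 : ContMDiff (𝓘(ℝ, ℝ).prod (model n)) 𝓘(ℝ, Amb n) ∞
        (fun q : ℝ × V n => T q.1 (incl q.2)) :=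
      hT.contMDiff.comp (contMDiff_fst.prodMk_space (contMDiff_incl.comp contMDiff_snd))
    exact contMDiff_toV (fun q : ℝ × V n => hu1 q.1 q.2) h1
  · intro p
    exact incl_injective (by rw [hφ, h0])
  · intro s _ p v
    set v₀ : Amb n := mfderiv (model n) 𝓘(ℝ, Amb n) incl p v with hv₀
    have hw : ∀ s, mfderiv (model n) 𝓘(ℝ, Amb n) incl (φ s p)
        (mfderiv (model n) (model n) (φ s) p v) = fderiv ℝ (T s) (incl p) v₀ := by
      intro s
      have h1 := mfderiv_comp_incl p ((hTs s).differentiable (by simp) (incl p)) v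
      rw [← h1]
      have h2 : T s ∘ incl = incl ∘ φ s := rfl
      rw [h2, mfderiv_comp p (mdifferentiableAt_incl _)
        ((φ s).contMDiff.mdifferentiable (by simp) p)]
      rfl
    have hform : ∀ s, contactForm (φ s p) (mfderiv (model n) (model n) (φ s) p v)
        = ambForm (T s (incl p)) (fderiv ℝ (T s) (incl p) v₀) := by
      intro s
      rw [contactForm_eq_ambForm, hw, hφ]
    have hlin : ∀ s, HasDerivAt (fun s => ambForm (T s (incl p)) (fderiv ℝ (T s) (incl p) v₀))
        (angDeriv (K s) (T s (incl p))
          * ambForm (T s (incl p)) (fderiv ℝ (T s) (incl p) v₀)) s := by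
      intro s
      have hKs : ContDiff ℝ ∞ (K s) := hK.comp (contDiff_const.prodMk contDiff_id)
      refine hasDerivAt_ambForm hKs (hd _ s) ?_ (hu1 s p) ?_
      · exact hasDerivAt_fderiv_flow hT (contDiff_contactField hK) hd (incl p) v₀ s
      · rw [← hw, ← hφ]
        exact re_conj_mul_mfderiv_incl _ _
    have hcont : Continuous fun s => angDeriv (K s) (T s (incl p)) :=
      (contDiff_angDeriv hK).continuous.comp (continuous_id.prodMk
        (hT.continuous.comp (continuous_id.prodMk continuous_const)))
    rw [hform, contactForm_eq_ambForm, eq_zero_iff_of_hasDerivAt_mul hcont hlin s]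
    have h00 : T 0 = id := funext h0
    rw [h00, fderiv_id]
    rfl
  · intro p s
    exact hd (incl p) s
  · intro p hp s
    exact incl_injective (by rw [hφ, hsupp _ hp])

/-! ### Transport of level sets by cut-off contact Hamiltonians -/

/-- The square `|x|² + |y|²` of the distance to the circle `{0} × S¹`. -/
def nsq (p : Amb n) : ℝ := ‖p.1.1‖ ^ 2 + ‖p.1.2‖ ^ 2

lemma contDiff_nsq : ContDiff ℝ ∞ (nsq (n := n)) :=
  ((contDiff_fst.comp contDiff_fst).norm_sq ℝ).add ((contDiff_snd.comp contDiff_fst).norm_sq ℝ)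

lemma nsq_nonneg (p : Amb n) : 0 ≤ nsq p := by unfold nsq; positivity

lemma contactField_congr {K k : Amb n → ℝ} {p : Amb n} (h : K =ᶠ[𝓝 p] k) :
    contactField K p = contactField k p := by
  have h1 : gradX K p = gradX k p := by simp only [gradX, h.fderiv_eq]
  have h2 : gradY K p = gradY k p := by simp only [gradY, h.fderiv_eq]
  simp only [contactField, angDeriv, angSpeed, h1, h2, h.fderiv_eq, h.self_of_nhds]

lemma angDeriv_congr {K k : Amb n → ℝ} {p : Amb n} (h : K =ᶠ[𝓝 p] k) :
    angDeriv K p = angDeriv k p := by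
  simp only [angDeriv, h.fderiv_eq]

/-- If `u` satisfies a linear equation `u' = m u` near each of its zeros, it cannot become
positive. -/
lemma nonpos_of_hasDerivAt_mul_near_zeros {u m : ℝ → ℝ} (hu : Continuous u) (hm : Continuous m)
    (h : ∀ s ∈ Icc (0 : ℝ) 1, u s = 0 →
      ∀ᶠ t in 𝓝 s, t ∈ Icc (0 : ℝ) 1 → HasDerivAt u (m t * u t) t)
    (h0 : u 0 ≤ 0) : u 1 ≤ 0 := by
  by_contra! h1
  set A : Set ℝ := Icc 0 1 ∩ {s | u s ≤ 0} with hA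
  have hAc : IsCompact A := isCompact_Icc.inter_right (isClosed_le hu continuous_const)
  have hAne : A.Nonempty := ⟨0, ⟨le_rfl, zero_le_one⟩, h0⟩
  set s₀ := sSup A with hs₀
  have hs₀A : s₀ ∈ A := hAc.sSup_mem hAne
  have hpos : ∀ s ∈ Ioc s₀ 1, 0 < u s := by
    intro s hs
    by_contra! hle
    exact absurd (le_csSup hAc.bddAbove (⟨⟨hs₀A.1.1.trans hs.1.le, hs.2⟩, hle⟩ : s ∈ A))
      (not_le.2 hs.1)
  have hlt : s₀ < 1 := lt_of_le_of_ne hs₀A.1.2 fun he =>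
    absurd hs₀A.2 (by rw [he]; exact not_le.2 h1)
  have hzero : u s₀ = 0 := by
    refine le_antisymm hs₀A.2 ?_
    refine ge_of_tendsto (hu.continuousAt.tendsto.mono_left nhdsWithin_le_nhds :
      Tendsto u (𝓝[>] s₀) (𝓝 (u s₀))) ?_
    filter_upwards [Ioc_mem_nhdsGT hlt] with s hs
    exact (hpos s hs).le
  obtain ⟨ε, hε, hball⟩ := Metric.eventually_nhds_iff.1 (h s₀ hs₀A.1 hzero)
  set b := min 1 (s₀ + ε / 2) with hb
  have hsb : s₀ < b := lt_min hlt (by linarith)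
  have hder : ∀ t ∈ Icc s₀ b, HasDerivAt u (m t * u t) t := by
    intro t ht
    have h2 : t ≤ s₀ + ε / 2 := ht.2.trans (min_le_right _ _)
    refine hball ?_ ⟨hs₀A.1.1.trans ht.1, ht.2.trans (min_le_left _ _)⟩
    rw [Real.dist_eq, abs_of_nonneg (by linarith [ht.1])]
    linarith
  obtain ⟨C, hC⟩ := isCompact_Icc.exists_bound_of_continuousOn (s := Icc s₀ b) hm.continuousOn
  have := eq_zero_of_abs_deriv_le_mul_abs_self_of_eq_zero_right (f := u) (K := C) hu.continuousOn
    (fun t ht => (hder t (Ico_subset_Icc_self ht)).hasDerivWithinAt) hzero (fun t ht => by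
      rw [norm_mul]
      exact mul_le_mul_of_nonneg_right (hC t (Ico_subset_Icc_self ht)) (norm_nonneg _)) b
      (right_mem_Icc.2 hsb.le)
  exact absurd this (hpos b ⟨hsb, min_le_left _ _⟩).ne'

/-- Let `k` be a contact Hamiltonian, smooth away from `{0} × S¹`, whose flow moves the level sets
`{G s = 1}` into each other, and let these level sets stay in the shell `c₁ < |x|² + |y|² < c₂`.
Cutting `k` off outside the shell gives a contact isotopy that moves the sublevel set `{G 0 ≤ 1}`
into `{G 1 ≤ 1}`. -/
theorem exists_transport {k G : ℝ → Amb n → ℝ} {c₁ c₂ c₃ : ℝ} (hc₁ : 0 < c₁) (hc₁₂ : c₁ < c₂)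
    (hc₂₃ : c₂ < c₃)
    (hk : ∀ q : ℝ × Amb n, nsq q.2 ≠ 0 → ContDiffAt ℝ ∞ (Function.uncurry k) q)
    (hG : Continuous (Function.uncurry G))
    (hshell : ∀ s ∈ Icc (0 : ℝ) 1, ∀ p : Amb n, ‖p.2‖ = 1 → G s p = 1 → nsq p ∈ Ioo c₁ c₂)
    (htrans : ∀ s (p : ℝ → Amb n), ‖(p s).2‖ = 1 → nsq (p s) ≠ 0 →
      HasDerivAt p (contactField (k s) (p s)) s →
      HasDerivAt (fun s => G s (p s)) (angDeriv (k s) (p s) * (G s (p s) - 1)) s) :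
    ∃ φ : ℝ → V n ≃ₘ^∞⟮model n, model n⟯ V n, IsContactIsotopy φ ∧
      (∀ p, c₃ < nsq (incl p) → ∀ s, φ s p = p) ∧
      (∀ p, G 0 (incl p) ≤ 1 → G 1 (incl (φ 1 p)) ≤ 1) := by
  let χ : ContDiffBump ((c₁ + c₂) / 2) :=
    { rIn := (c₂ - c₁) / 2
      rOut := (c₂ - c₁) / 2 + min (c₁ / 2) (c₃ - c₂)
      rIn_pos := by linarith
      rIn_lt_rOut := by
        have : 0 < min (c₁ / 2) (c₃ - c₂) := lt_min (by linarith) (by linarith)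
        linarith }
  let χs : ContDiffBump (0 : ℝ) := ⟨2, 3, by norm_num, by norm_num⟩
  let χe : ContDiffBump (0 : ℂ) := ⟨2, 3, by norm_num, by norm_num⟩
  have hχ1 : ∀ r ∈ Icc c₁ c₂, χ r = 1 := by
    intro r hr
    refine χ.one_of_mem_closedBall ?_
    rw [Real.closedBall_eq_Icc]
    constructor <;> simp only [χ] <;> linarith [hr.1, hr.2]
  have hχ0 : ∀ r, (r ≤ c₁ / 2 ∨ c₃ ≤ r) → χ r = 0 := by
    intro r hr
    refine χ.zero_of_le_dist ?_
    have h1 := min_le_left (c₁ / 2) (c₃ - c₂)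
    have h2 := min_le_right (c₁ / 2) (c₃ - c₂)
    simp only [χ, Real.dist_eq]
    rcases hr with hr | hr
    · rw [le_abs]; right; linarith
    · rw [le_abs]; left; linarith
  let K : ℝ → Amb n → ℝ := fun s p => χs s * (χe p.2 * (χ (nsq p) * k s p))
  have hK : ContDiff ℝ ∞ (Function.uncurry K) := by
    refine contDiff_iff_contDiffAt.2 fun q => ?_
    by_cases hq : nsq q.2 = 0
    · have h1 : ∀ᶠ r : ℝ × Amb n in 𝓝 q, nsq r.2 < c₁ / 2 := by
        have hc : Continuous fun r : ℝ × Amb n => nsq r.2 :=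
          contDiff_nsq.continuous.comp continuous_snd
        refine hc.continuousAt.eventually_lt continuousAt_const ?_
        simp only [hq]
        linarith
      have h2 : Function.uncurry K =ᶠ[𝓝 q] fun _ => 0 := by
        filter_upwards [h1] with r hr
        simp [K, Function.uncurry_def, hχ0 _ (Or.inl hr.le)]
      exact contDiffAt_const.congr_of_eventuallyEq h2
    · have h1 : ContDiffAt ℝ ∞ (fun r : ℝ × Amb n => χs r.1) q :=
        (χs.contDiff.comp contDiff_fst).contDiffAt
      have h2 : ContDiffAt ℝ ∞ (fun r : ℝ × Amb n => χe r.2.2) q :=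
        (χe.contDiff.comp (contDiff_snd.comp contDiff_snd)).contDiffAt
      have h3 : ContDiffAt ℝ ∞ (fun r : ℝ × Amb n => χ (nsq r.2)) q :=
        (χ.contDiff.comp (contDiff_nsq.comp contDiff_snd)).contDiffAt
      exact h1.mul (h2.mul (h3.mul (hk q hq)))
  have hsmall : ∀ q : ℝ × Amb n, c₃ ≤ nsq q.2 → Function.uncurry K q = 0 := by
    intro q hq
    simp [K, Function.uncurry_def, hχ0 _ (Or.inr hq)]
  have hKc : HasCompactSupport (Function.uncurry K) := by
    refine HasCompactSupport.intro (isCompact_closedBall (0 : ℝ × Amb n) (3 + c₃ + 1))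
      fun q hq => ?_
    by_contra hne
    apply hq
    have h1 : ‖q.1‖ ≤ 3 := by
      by_contra! h
      exact hne (by simp [K, Function.uncurry_def, χs.zero_of_le_dist
        (by rw [dist_zero_right]; exact h.le : χs.rOut ≤ dist q.1 0)])
    have h2 : ‖q.2.2‖ ≤ 3 := by
      by_contra! h
      exact hne (by simp [K, Function.uncurry_def, χe.zero_of_le_dist
        (by rw [dist_zero_right]; exact h.le : χe.rOut ≤ dist q.2.2 0)])
    have h3 : nsq q.2 < c₃ := by
      by_contra! h
      exact hne (hsmall q h)
    unfold nsq at h3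
    rw [mem_closedBall_zero_iff, Prod.norm_def, Prod.norm_def, Prod.norm_def]
    refine max_le (by linarith) (max_le (max_le ?_ ?_) (by linarith))
    · nlinarith [sq_nonneg ‖q.2.1.2‖, sq_nonneg (‖q.2.1.1‖ - 1)]
    · nlinarith [sq_nonneg ‖q.2.1.1‖, sq_nonneg (‖q.2.1.2‖ - 1)]
  obtain ⟨φ, hφ, hd, hsupp⟩ := exists_contactIsotopy hK hKc
  refine ⟨φ, hφ, fun p hp => hsupp p fun s hs => ?_, fun p hp => ?_⟩
  · have hcl : IsClosed {q : ℝ × Amb n | nsq q.2 ≤ c₃} :=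
      isClosed_le (contDiff_nsq.continuous.comp continuous_snd) continuous_const
    have : tsupport (Function.uncurry K) ⊆ {q : ℝ × Amb n | nsq q.2 ≤ c₃} := by
      refine closure_minimal (fun q hq => ?_) hcl
      by_contra h
      exact hq (hsmall q (not_le.1 h).le)
    exact absurd (this hs) (not_le.2 hp)
  · set γ : ℝ → Amb n := fun s => incl (φ s p) with hγ
    have hγc : Continuous γ := continuous_iff_continuousAt.2 fun s => (hd p s).continuousAt
    have hγ0 : γ 0 = incl p := by simp only [hγ, hφ.start p]
    have hu : Continuous fun s => G s (γ s) - 1 :=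
      (hG.comp (continuous_id.prodMk hγc)).sub continuous_const
    have hm : Continuous fun s => angDeriv (K s) (γ s) :=
      (contDiff_angDeriv hK).continuous.comp (continuous_id.prodMk hγc)
    have := nonpos_of_hasDerivAt_mul_near_zeros hu hm ?_ (by rw [hγ0]; linarith)
    · simp only [hγ] at this
      linarith
    intro s hs hus
    have hnorm : ∀ t, ‖(γ t).2‖ = 1 := fun t => norm_incl_snd _
    have hs1 := hshell s hs (γ s) (hnorm s) (by linarith)
    have hopen : ∀ᶠ t in 𝓝 s, nsq (γ t) ∈ Ioo c₁ c₂ :=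
      (contDiff_nsq.continuous.comp hγc).continuousAt.eventually (isOpen_Ioo.mem_nhds hs1)
    filter_upwards [hopen] with t ht htI
    have heq : K t =ᶠ[𝓝 (γ t)] k t := by
      have h1 : ∀ᶠ r in 𝓝 (γ t), nsq r ∈ Ioo c₁ c₂ :=
        contDiff_nsq.continuous.continuousAt.eventually (isOpen_Ioo.mem_nhds ht)
      have h2 : ∀ᶠ r in 𝓝 (γ t), ‖r.2‖ < 2 :=
        (continuous_norm.comp continuous_snd).continuousAt.eventually_lt continuousAt_const
          (by simp [hnorm t])
      have h3 : χs t = 1 := χs.one_of_mem_closedBall (by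
        rw [mem_closedBall_zero_iff, Real.norm_eq_abs, abs_of_nonneg htI.1]
        show t ≤ 2
        linarith [htI.2])
      filter_upwards [h1, h2] with r hr1 hr2
      have h4 : χe r.2 = 1 := χe.one_of_mem_closedBall (by
        rw [mem_closedBall_zero_iff]; exact hr2.le)
      simp [K, h3, h4, hχ1 _ (Ioo_subset_Icc_self hr1)]
    have hdt := hd p t
    rw [contactField_congr heq] at hdt
    rw [angDeriv_congr heq]
    exact (htrans t γ (hnorm t) (by linarith [ht.1]) hdt).sub_const 1

/-! ### Coordinates along the trajectories of a contact field -/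

/-- The complex coordinate `x_i + √-1 y_i`, as a linear map. -/
def zc (i : Fin n) : Amb n →L[ℝ] ℂ :=
  Complex.equivRealProdCLM.symm.toContinuousLinearMap.comp
    (((EuclideanSpace.proj i).comp
        ((ContinuousLinearMap.fst ℝ (E n) (E n)).comp (ContinuousLinearMap.fst ℝ _ ℂ))).prod
      ((EuclideanSpace.proj i).comp
        ((ContinuousLinearMap.snd ℝ (E n) (E n)).comp (ContinuousLinearMap.fst ℝ _ ℂ))))

@[simp] lemma zc_re (i : Fin n) (p : Amb n) : (zc i p).re = p.1.1 i := by
  simp [zc]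

@[simp] lemma zc_im (i : Fin n) (p : Amb n) : (zc i p).im = p.1.2 i := by
  simp [zc]

lemma zc_single_fst (l i : Fin n) :
    zc l ((EuclideanSpace.single i 1, 0), 0) = if l = i then 1 else 0 := by
  apply Complex.ext <;> by_cases h : l = i <;> simp [h]

lemma zc_single_snd (l i : Fin n) :
    zc l ((0, EuclideanSpace.single i 1), 0) = if l = i then Complex.I else 0 := by
  apply Complex.ext <;> by_cases h : l = i <;> simp [h]

lemma zc_symplectic_rotation (l : Fin n) (p : Amb n) :
    zc l ((p.1.2, -p.1.1), (0 : ℂ)) = -Complex.I * zc l p := by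
  apply Complex.ext <;> simp

lemma zc_horizontal (l : Fin n) (p : Amb n) : zc l (p.1, (0 : ℂ)) = zc l p := by
  apply Complex.ext <;> simp

lemma zc_vertical (l : Fin n) (c : ℂ) : zc l ((0 : E n × E n), c) = 0 := by
  apply Complex.ext <;> simp

lemma normSq_zc_add_le {i j : Fin n} (hij : i ≠ j) (p : Amb n) :
    Complex.normSq (zc i p) + Complex.normSq (zc j p) ≤ nsq p := by
  have h : ∀ x : E n, x i * x i + x j * x j ≤ ‖x‖ ^ 2 := by
    intro x
    rw [EuclideanSpace.norm_sq_eq, ← Finset.sum_pair (f := fun l => x l * x l) hij]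
    refine (Finset.sum_le_sum_of_subset_of_nonneg (Finset.subset_univ _)
      fun l _ _ => mul_self_nonneg (x l)).trans_eq ?_
    exact Finset.sum_congr rfl fun l _ => by rw [Real.norm_eq_abs, sq_abs, sq]
  have h1 := h p.1.1
  have h2 := h p.1.2
  simp only [Complex.normSq_apply, zc_re, zc_im, nsq]
  linarith

/-- The equations of motion in complex coordinates. The last one says that `e` does not move where
the contact Hamiltonian satisfies Euler's identity for functions of degree two in `(x, y)`. -/
lemma hasDerivAt_coords {k : Amb n → ℝ} {p : ℝ → Amb n} {s : ℝ}
    (hp : HasDerivAt p (contactField k (p s)) s) :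
    (∀ i, HasDerivAt (fun s => zc i (p s))
      (-(fderiv ℝ k (p s) ((0, EuclideanSpace.single i 1), 0) : ℂ)
        + (fderiv ℝ k (p s) ((EuclideanSpace.single i 1, 0), 0) : ℂ) * Complex.I
        + (angDeriv k (p s) / 2 : ℝ) * zc i (p s)) s) ∧
    HasDerivAt (fun s => nsq (p s))
      (2 * fderiv ℝ k (p s) (((p s).1.2, -(p s).1.1), 0) + angDeriv k (p s) * nsq (p s)) s ∧
    (k (p s) = fderiv ℝ k (p s) ((p s).1, 0) / 2 → HasDerivAt (fun s => (p s).2) 0 s) := by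
  refine ⟨fun i => ?_, ?_, fun h => ?_⟩
  · refine ((zc i).hasFDerivAt.comp_hasDerivAt s hp).congr_deriv ?_
    apply Complex.ext
    · simp [contactField, gradY]
    · simp [contactField, gradX]
  · have h1 := (HasDerivAt.norm_sq hp.fst.fst).add (HasDerivAt.norm_sq hp.fst.snd)
    refine h1.congr_deriv ?_
    have h2 : (((p s).1.2, -(p s).1.1), (0 : ℂ))
        = (((p s).1.2, 0), 0) - ((0, (p s).1.1), 0) := by simp
    rw [h2, map_sub, ← inner_gradX, ← inner_gradY]
    simp only [contactField, inner_add_right, inner_neg_right, inner_smul_right, nsq,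
      real_inner_self_eq_norm_sq]
    rw [real_inner_comm (p s).1.1, real_inner_comm (p s).1.2]
    ring
  · have h1 : angSpeed k (p s) = 0 := by
      have h2 : ((p s).1, (0 : ℂ)) = (((p s).1.1, 0), 0) + ((0, (p s).1.2), 0) := by simp
      rw [angSpeed, h, h2, map_add, ← inner_gradX, ← inner_gradY, real_inner_comm,
        real_inner_comm (gradY k (p s))]
      ring
    have h3 : HasDerivAt (fun s => (p s).2) (contactField k (p s)).2 s := hp.snd
    have h4 : (contactField k (p s)).2 = 0 := by simp [contactField, h1]
    rwa [h4] at h3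

lemma hasDerivAt_re {f : ℝ → ℂ} {f' : ℂ} {s : ℝ} (h : HasDerivAt f f' s) :
    HasDerivAt (fun s => (f s).re) f'.re s := Complex.reCLM.hasFDerivAt.comp_hasDerivAt s h

lemma hasDerivAt_im {f : ℝ → ℂ} {f' : ℂ} {s : ℝ} (h : HasDerivAt f f' s) :
    HasDerivAt (fun s => (f s).im) f'.im s := Complex.imCLM.hasFDerivAt.comp_hasDerivAt s h

lemma hasDerivAt_conj {f : ℝ → ℂ} {f' : ℂ} {s : ℝ} (h : HasDerivAt f f' s) :
    HasDerivAt (fun s => conj (f s)) (conj f') s :=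
  Complex.conjCLE.toContinuousLinearMap.hasFDerivAt.comp_hasDerivAt s h

lemma hasDerivAt_normSq {f : ℝ → ℂ} {f' : ℂ} {s : ℝ} (h : HasDerivAt f f' s) :
    HasDerivAt (fun s => Complex.normSq (f s)) (2 * (conj (f s) * f').re) s := by
  have h1 := ((hasDerivAt_re h).mul (hasDerivAt_re h)).add ((hasDerivAt_im h).mul (hasDerivAt_im h))
  refine h1.congr_deriv ?_
  simp only [Complex.mul_re, Complex.conj_re, Complex.conj_im]
  ring

lemma re_conj_mul_real_smul (τ : ℝ) (w : ℂ) :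
    (conj w * ((τ / 2 : ℝ) * w)).re = τ / 2 * Complex.normSq w := by
  have : conj w * ((τ / 2 : ℝ) * w) = ((τ / 2 * Complex.normSq w : ℝ) : ℂ) := by
    push_cast
    rw [Complex.normSq_eq_conj_mul_self]
    ring
  rw [this, Complex.ofReal_re]

/-- If the flows of the `k s` move the level sets `{π q s = 1}` into each other, which for `π q s`
means the equation `htrans`, and if `q` is comparable to `N = |x|² + |y|²`, then there is a contact
isotopy that moves `{π q 0 ≤ 1}` into `{π q 1 ≤ 1}` and is supported in any given neighbourhood of
`{π L N ≤ 1}`. -/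
theorem exists_transport_of_bounds {k q : ℝ → Amb n → ℝ} {L Λ c : ℝ} (hL : 0 < L)
    (hc : 1 / (Real.pi * L) < c)
    (hk : ∀ r : ℝ × Amb n, nsq r.2 ≠ 0 → ContDiffAt ℝ ∞ (Function.uncurry k) r)
    (hq : Continuous (Function.uncurry q))
    (hlow : ∀ s ∈ Icc (0 : ℝ) 1, ∀ p : Amb n, ‖p.2‖ = 1 → L * nsq p ≤ q s p)
    (hupp : ∀ s ∈ Icc (0 : ℝ) 1, ∀ p : Amb n, ‖p.2‖ = 1 → q s p ≤ Λ * nsq p)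
    (htrans : ∀ s (p : ℝ → Amb n), ‖(p s).2‖ = 1 → nsq (p s) ≠ 0 →
      HasDerivAt p (contactField (k s) (p s)) s →
      HasDerivAt (fun s => q s (p s))
        (angDeriv (k s) (p s) * q s (p s) - angDeriv (k s) (p s) / Real.pi) s) :
    ∃ φ : ℝ → V n ≃ₘ^∞⟮model n, model n⟯ V n, IsContactIsotopy φ ∧
      (∀ p, c < nsq (incl p) → ∀ s, φ s p = p) ∧
      (∀ p, Real.pi * q 0 (incl p) ≤ 1 → Real.pi * q 1 (incl (φ 1 p)) ≤ 1) := by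
  have hpi := Real.pi_pos
  set Λ' := max Λ L with hΛ'
  have hΛ0 : 0 < Λ' := lt_of_lt_of_le hL (le_max_right _ _)
  have h1 : 1 / (Real.pi * Λ') ≤ 1 / (Real.pi * L) := by
    have := le_max_right Λ L
    gcongr
  obtain ⟨c₂, hc₂, hc₂'⟩ := exists_between hc
  refine exists_transport (k := k) (G := fun s p => Real.pi * q s p)
    (c₁ := 1 / (Real.pi * Λ') / 2) (c₂ := c₂) (by positivity) ?_ hc₂' hk
    (continuous_const.mul hq) ?_ ?_
  · have : 0 < 1 / (Real.pi * Λ') := by positivity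
    linarith
  · intro s hs p hp h
    have hl := hlow s hs p hp
    have hu : q s p ≤ Λ' * nsq p :=
      (hupp s hs p hp).trans (mul_le_mul_of_nonneg_right (le_max_left _ _) (nsq_nonneg p))
    constructor
    · have h3 : 1 / (Real.pi * Λ') ≤ nsq p := by
        rw [div_le_iff₀ (by positivity)]
        nlinarith
      have : 0 < 1 / (Real.pi * Λ') := by positivity
      linarith
    · have h3 : nsq p ≤ 1 / (Real.pi * L) := by
        rw [le_div_iff₀ (by positivity)]
        nlinarith
      linarith
  · intro s p hp hN hd
    refine ((htrans s p hp hN hd).const_mul Real.pi).congr_deriv ?_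
    field_simp

/-! ### Loops of rotations in two complex coordinates -/

/-- The contact Hamiltonian generating a family of loops of rotations in the coordinates `z_i`
and `z_j`, with angular velocity `a`. -/
def rotHam (a : ℝ) (i j : Fin n) (p : Amb n) : ℝ :=
  -a * (conj (zc i p) * conj p.2 * zc j p).im

lemma contDiff_rotHam (a : ℝ) (i j : Fin n) : ContDiff ℝ ∞ (rotHam a i j) := by
  have hc : ContDiff ℝ ∞ (fun z : ℂ => conj z) := Complex.conjCLE.contDiff
  exact contDiff_const.mul (Complex.imCLM.contDiff.comp
    (((hc.comp (zc i).contDiff).mul (hc.comp contDiff_snd)).mul (zc j).contDiff))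

lemma fderiv_rotHam (a : ℝ) (i j : Fin n) (p w : Amb n) :
    fderiv ℝ (rotHam a i j) p w = -a * (conj (zc i w) * conj p.2 * zc j p
      + conj (zc i p) * conj w.2 * zc j p + conj (zc i p) * conj p.2 * zc j w).im := by
  have h1 : HasFDerivAt (fun p : Amb n => conj (zc i p)) _ p :=
    Complex.conjCLE.toContinuousLinearMap.hasFDerivAt.comp p (zc i).hasFDerivAt
  have h2 : HasFDerivAt (fun p : Amb n => conj p.2) _ p :=
    Complex.conjCLE.toContinuousLinearMap.hasFDerivAt.comp p hasFDerivAt_snd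
  have h3 := (Complex.imCLM.hasFDerivAt.comp p ((h1.mul h2).mul (zc j).hasFDerivAt)).const_mul (-a)
  have h4 : HasFDerivAt (rotHam a i j) _ p := h3
  rw [h4.fderiv]
  simp
  ring

/-- The angle `β` at time `s` along the contraction of a loop of rotations; it decreases from
`π/2`, where the loop is constant, to `0`. -/
def rotAngle (s : ℝ) : ℝ := Real.pi / 2 * (1 - s)

/-- The first coordinate of the inverse of the rotation `[[ē cos β, -sin β], [sin β, e cos β]]`
applied to `(z, z')`. -/
def rotFst (β : ℝ) (e z z' : ℂ) : ℂ := Real.cos β * e * z + Real.sin β * z'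

/-- The second coordinate of the inverse of the rotation `[[ē cos β, -sin β], [sin β, e cos β]]`
applied to `(z, z')`. -/
def rotSnd (β : ℝ) (e z z' : ℂ) : ℂ := -Real.sin β * z + Real.cos β * conj e * z'

lemma normSq_rot (β : ℝ) {e : ℂ} (he : ‖e‖ = 1) (z z' : ℂ) :
    Complex.normSq (rotFst β e z z') + Complex.normSq (rotSnd β e z z')
      = Complex.normSq z + Complex.normSq z' := by
  have h1 : e.re * e.re + e.im * e.im = 1 := by
    rw [← Complex.normSq_apply, Complex.normSq_eq_norm_sq, he]; norm_num
  have h2 := Real.sin_sq_add_cos_sq β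
  simp only [rotFst, rotSnd, Complex.normSq_apply, Complex.add_re, Complex.add_im, Complex.mul_re,
    Complex.mul_im, Complex.ofReal_re, Complex.ofReal_im, Complex.neg_re, Complex.neg_im,
    Complex.conj_re, Complex.conj_im]
  linear_combination (Real.cos β ^ 2 * (z.re ^ 2 + z.im ^ 2 + z'.re ^ 2 + z'.im ^ 2)) * h1
    + (z.re ^ 2 + z.im ^ 2 + z'.re ^ 2 + z'.im ^ 2) * h2

/-- A function of `N = |x|² + |y|²`, two complex coordinates and `e` that is homogeneous of degree
two in the sense that it follows every scaling of `N` by `r²` and of the coordinates by `r`, in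
infinitesimal form. -/
def IsQuadratic (Q : ℝ → ℂ → ℂ → ℂ → ℝ) : Prop :=
  ∀ (N : ℝ → ℝ) (ζ w e : ℝ → ℂ) (τ s : ℝ), 0 < N s → HasDerivAt N (τ * N s) s →
    HasDerivAt ζ ((τ / 2 : ℝ) * ζ s) s → HasDerivAt w ((τ / 2 : ℝ) * w s) s →
    HasDerivAt e 0 s →
    HasDerivAt (fun s => Q (N s) (ζ s) (w s) (e s)) (τ * Q (N s) (ζ s) (w s) (e s)) s

/-- The degree-two function whose sublevel sets are moved by a family of loops of rotations: the
result of acting by the loop on `κ N + Q`. -/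
def rotForm (κ : ℝ) (Q : ℝ → ℂ → ℂ → ℂ → ℝ) (i j : Fin n) (s : ℝ) (p : Amb n) : ℝ :=
  κ * nsq p + Complex.normSq (zc i p)
    - Complex.normSq (rotSnd (rotAngle s) p.2 (zc i p) (zc j p))
    + Q (nsq p) (rotFst (rotAngle s) p.2 (zc i p) (zc j p))
        (rotSnd (rotAngle s) p.2 (zc i p) (zc j p)) p.2

/-- The transport equation for `rotForm`. Along the trajectories of `rotHam`, the rotated
coordinates and `N` are only rescaled, by the conformal factor `τ` of the contact flow; the inhomogeneous term
comes from `|z_i|²`. -/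
lemma rotForm_transport (κ : ℝ) {Q : ℝ → ℂ → ℂ → ℂ → ℝ} (hQ : IsQuadratic Q) {i j : Fin n}
    (hij : i ≠ j) (s : ℝ) (p : ℝ → Amb n) (hp : ‖(p s).2‖ = 1) (hN : nsq (p s) ≠ 0)
    (hd : HasDerivAt p (contactField (rotHam (-(Real.pi / 2)) i j) (p s)) s) :
    HasDerivAt (fun s => rotForm κ Q i j s (p s))
      (angDeriv (rotHam (-(Real.pi / 2)) i j) (p s) * rotForm κ Q i j s (p s)
        - angDeriv (rotHam (-(Real.pi / 2)) i j) (p s) / Real.pi) s := by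
  obtain ⟨hz, hnsq, he⟩ := hasDerivAt_coords hd
  set a : ℝ := -(Real.pi / 2) with ha
  set τ : ℝ := angDeriv (rotHam a i j) (p s) with hτ
  set zi := zc i (p s) with hzi
  set zj := zc j (p s) with hzj
  set e := (p s).2 with he_def
  have hpi := Real.pi_ne_zero
  have hzi' : HasDerivAt (fun s => zc i (p s)) (-a * conj e * zj + (τ / 2 : ℝ) * zi) s := by
    refine (hz i).congr_deriv ?_
    rw [fderiv_rotHam, fderiv_rotHam, zc_single_fst, zc_single_fst, zc_single_snd, zc_single_snd]
    apply Complex.ext <;> simp [hij.symm, hzi, hzj, he_def] <;> ring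
  have hzj' : HasDerivAt (fun s => zc j (p s)) (a * e * zi + (τ / 2 : ℝ) * zj) s := by
    refine (hz j).congr_deriv ?_
    rw [fderiv_rotHam, fderiv_rotHam, zc_single_fst, zc_single_fst, zc_single_snd, zc_single_snd]
    apply Complex.ext <;> simp [hij, hzi, hzj, he_def] <;> ring
  have hN' : HasDerivAt (fun s => nsq (p s)) (τ * nsq (p s)) s := by
    refine hnsq.congr_deriv ?_
    have h2 : conj (-Complex.I * zi) * conj e * zj + conj zi * conj (0 : ℂ) * zj
        + conj zi * conj e * (-Complex.I * zj) = 0 := by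
      simp only [map_mul, map_neg, Complex.conj_I, map_zero]
      ring
    rw [fderiv_rotHam, zc_symplectic_rotation, zc_symplectic_rotation, h2]
    simp
  have he' : HasDerivAt (fun s => (p s).2) 0 s := by
    refine he ?_
    rw [fderiv_rotHam, zc_horizontal, zc_horizontal, rotHam]
    simp
    ring
  have hτ' : τ = 2 * Real.pi * a * (conj zi * conj e * zj).re := by
    rw [hτ, angDeriv, fderiv_rotHam, zc_vertical, zc_vertical]
    simp only [map_zero, zero_mul, mul_zero, zero_add, add_zero, map_mul, Complex.conj_I,
      Complex.conj_ofReal]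
    have : conj zi * (((2 * Real.pi : ℝ) : ℂ) * -Complex.I * conj e) * zj
        = -((2 * Real.pi : ℝ) : ℂ) * (conj zi * conj e * zj * Complex.I) := by ring
    rw [this, ← Complex.ofReal_neg, Complex.im_ofReal_mul, Complex.mul_I_im]
    ring
  have hβ : HasDerivAt rotAngle a s := by
    have := ((hasDerivAt_const s (1 : ℝ)).sub (hasDerivAt_id s)).const_mul (Real.pi / 2)
    exact this.congr_deriv (by rw [ha]; ring)
  have hcos : HasDerivAt (fun s => (Real.cos (rotAngle s) : ℂ))
      ((-Real.sin (rotAngle s) * a : ℝ) : ℂ) s := hβ.cos.ofReal_comp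
  have hsin : HasDerivAt (fun s => (Real.sin (rotAngle s) : ℂ))
      ((Real.cos (rotAngle s) * a : ℝ) : ℂ) s := hβ.sin.ofReal_comp
  have hee : e * conj e = 1 := by
    rw [Complex.mul_conj, Complex.normSq_eq_norm_sq, hp]; norm_num
  have hζ : HasDerivAt (fun s => rotFst (rotAngle s) (p s).2 (zc i (p s)) (zc j (p s)))
      ((τ / 2 : ℝ) * rotFst (rotAngle s) e zi zj) s := by
    refine (((hcos.mul he').mul hzi').add (hsin.mul hzj')).congr_deriv ?_
    simp only [Pi.mul_apply]
    rw [← he_def, ← hzi, ← hzj, rotFst]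
    push_cast
    linear_combination (-Complex.cos (rotAngle s) * a * zj) * hee
  have hw : HasDerivAt (fun s => rotSnd (rotAngle s) (p s).2 (zc i (p s)) (zc j (p s)))
      ((τ / 2 : ℝ) * rotSnd (rotAngle s) e zi zj) s := by
    refine ((hsin.neg.mul hzi').add ((hcos.mul (hasDerivAt_conj he')).mul hzj')).congr_deriv ?_
    simp only [Pi.neg_apply, Pi.mul_apply, map_zero]
    rw [← he_def, ← hzi, ← hzj, rotSnd]
    push_cast
    linear_combination (Complex.cos (rotAngle s) * a * zi) * hee
  have hQ' := hQ _ _ _ _ τ s (lt_of_le_of_ne (nsq_nonneg _) hN.symm) hN' hζ hw he'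
  have hi2 := hasDerivAt_normSq hzi'
  have hw2 := hasDerivAt_normSq hw
  refine ((((hN'.const_mul κ).add hi2).sub hw2).add hQ').congr_deriv ?_
  have e1 : (conj zi * (-a * conj e * zj + (τ / 2 : ℝ) * zi)).re
      = -a * (conj zi * conj e * zj).re + τ / 2 * Complex.normSq zi := by
    have : conj zi * (-a * conj e * zj + (τ / 2 : ℝ) * zi)
        = ((-a : ℝ) : ℂ) * (conj zi * conj e * zj)
          + ((τ / 2 * Complex.normSq zi : ℝ) : ℂ) := by
      push_cast
      rw [Complex.normSq_eq_conj_mul_self]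
      ring
    rw [this, Complex.add_re, Complex.re_ofReal_mul, Complex.ofReal_re]
  rw [e1, re_conj_mul_real_smul, rotForm]
  have e3 : τ / Real.pi = 2 * a * (conj zi * conj e * zj).re := by
    rw [hτ']; field_simp
  rw [e3]
  ring

/-- Contact isotopies realising the action of a contraction of a loop of rotations. -/
theorem exists_rotation_isotopy {κ L Λ c : ℝ} {Q : ℝ → ℂ → ℂ → ℂ → ℝ} (hQ : IsQuadratic Q)
    (hQc : Continuous fun v : ℝ × ℂ × ℂ × ℂ => Q v.1 v.2.1 v.2.2.1 v.2.2.2) {i j : Fin n}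
    (hij : i ≠ j) (hL : 0 < L) (hc : 1 / (Real.pi * L) < c)
    (hlow : ∀ s ∈ Icc (0 : ℝ) 1, ∀ p : Amb n, ‖p.2‖ = 1 → L * nsq p ≤ rotForm κ Q i j s p)
    (hupp : ∀ s ∈ Icc (0 : ℝ) 1, ∀ p : Amb n, ‖p.2‖ = 1 → rotForm κ Q i j s p ≤ Λ * nsq p) :
    ∃ φ : ℝ → V n ≃ₘ^∞⟮model n, model n⟯ V n, IsContactIsotopy φ ∧
      (∀ p, c < nsq (incl p) → ∀ s, φ s p = p) ∧
      (∀ p, Real.pi * rotForm κ Q i j 0 (incl p) ≤ 1 →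
        Real.pi * rotForm κ Q i j 1 (incl (φ 1 p)) ≤ 1) := by
  refine exists_transport_of_bounds (k := fun _ => rotHam (-(Real.pi / 2)) i j) hL hc
    ?_ ?_ hlow hupp
    fun s p hp hN hd => rotForm_transport κ hQ hij s p hp hN hd
  · intro r _
    exact ((contDiff_rotHam _ i j).comp contDiff_snd).contDiffAt
  · have hang : Continuous fun q : ℝ × Amb n => rotAngle q.1 := by unfold rotAngle; fun_prop
    have hcos : Continuous fun q : ℝ × Amb n => (Real.cos (rotAngle q.1) : ℂ) :=
      Complex.continuous_ofReal.comp (Real.continuous_cos.comp hang)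
    have hsin : Continuous fun q : ℝ × Amb n => (Real.sin (rotAngle q.1) : ℂ) :=
      Complex.continuous_ofReal.comp (Real.continuous_sin.comp hang)
    have hzi : Continuous fun q : ℝ × Amb n => zc i q.2 := (zc i).continuous.comp continuous_snd
    have hzj : Continuous fun q : ℝ × Amb n => zc j q.2 := (zc j).continuous.comp continuous_snd
    have he : Continuous fun q : ℝ × Amb n => q.2.2 := continuous_snd.comp continuous_snd
    have hN : Continuous fun q : ℝ × Amb n => nsq q.2 :=
      contDiff_nsq.continuous.comp continuous_snd
    have hζ : Continuous fun q : ℝ × Amb n =>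
        rotFst (rotAngle q.1) q.2.2 (zc i q.2) (zc j q.2) :=
      ((hcos.mul he).mul hzi).add (hsin.mul hzj)
    have hw : Continuous fun q : ℝ × Amb n =>
        rotSnd (rotAngle q.1) q.2.2 (zc i q.2) (zc j q.2) :=
      (hsin.neg.mul hzi).add ((hcos.mul (Complex.continuous_conj.comp he)).mul hzj)
    exact (((continuous_const.mul hN).add (Complex.continuous_normSq.comp hzi)).sub
      (Complex.continuous_normSq.comp hw)).add
      (hQc.comp (hN.prodMk (hζ.prodMk (hw.prodMk he))))

/-! ### Boosts of the loop of rotations -/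

/-- The effect on the loop of rotations with generator `2 S - N`, followed by the rotations with
generator `δ N`, of conjugating the loop by the boost of rapidity `b`. The first three terms are
the boosted generator of the loop; the factor of `δ` is the transform of `N` by the boosted loop
at `e`. -/
def boostForm (δ b : ℝ) (e : ℂ) (S C X Y M : ℝ) : ℝ :=
  (Real.cosh b * S - Real.sinh b * X) - C / 2 - M
    + δ * (Real.cosh b * (Real.cosh b * S - Real.sinh b * X)
      + Real.sinh b * (e.re * (Real.cosh b * X - Real.sinh b * S) - e.im * Y) + C / 2)

/-- `boostForm` as a function of `N = |x|² + |y|²`, of two complex coordinates `ζ`, `w`, and of `e`.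
The coordinate `ζ` enters in the frame rotated by `e ^ k`. -/
def boostQuad (k : ℕ) (δ b N : ℝ) (ζ w e : ℂ) : ℝ :=
  boostForm δ b e ((N + Complex.normSq ζ) / 2) (N - Complex.normSq ζ)
    (Real.sqrt N * (e ^ k * ζ).re) (Real.sqrt N * (e ^ k * ζ).im) (Complex.normSq w)

/-- The contact Hamiltonian generating, at rapidity `b` and boost rate `a`, the conjugation of the
loop of rotations by boosts. -/
def boostHam (k : ℕ) (a b : ℝ) (j : Fin n) (p : Amb n) : ℝ :=
  a / 2 * ((p.2.re - 1) * (Real.sqrt (nsq p) * (p.2 ^ k * zc j p).im)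
    + p.2.im * (Real.cosh b * (Real.sqrt (nsq p) * (p.2 ^ k * zc j p).re)
      - Real.sinh b * ((nsq p + Complex.normSq (zc j p)) / 2)))

lemma hasDerivAt_sqrt_mul_re {N : ℝ → ℝ} {Z : ℝ → ℂ} {N' s : ℝ} {Z' : ℂ} (hN : HasDerivAt N N' s)
    (hZ : HasDerivAt Z Z' s) (h0 : 0 < N s) :
    HasDerivAt (fun s => Real.sqrt (N s) * (Z s).re)
      (N' / (2 * Real.sqrt (N s)) * (Z s).re + Real.sqrt (N s) * Z'.re) s :=
  (hN.sqrt h0.ne').mul (hasDerivAt_re hZ)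

lemma hasDerivAt_sqrt_mul_im {N : ℝ → ℝ} {Z : ℝ → ℂ} {N' s : ℝ} {Z' : ℂ} (hN : HasDerivAt N N' s)
    (hZ : HasDerivAt Z Z' s) (h0 : 0 < N s) :
    HasDerivAt (fun s => Real.sqrt (N s) * (Z s).im)
      (N' / (2 * Real.sqrt (N s)) * (Z s).im + Real.sqrt (N s) * Z'.im) s :=
  (hN.sqrt h0.ne').mul (hasDerivAt_im hZ)

lemma isQuadratic_boostQuad (k : ℕ) (δ b : ℝ) : IsQuadratic (boostQuad k δ b) := by
  intro N ζ w e τ s h0 hN hζ hw he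
  have hek : HasDerivAt (fun s => e s ^ k) 0 s := (he.pow k).congr_deriv (by simp)
  have hZ : HasDerivAt (fun s => e s ^ k * ζ s) ((τ / 2 : ℝ) * (e s ^ k * ζ s)) s :=
    (hek.mul hζ).congr_deriv (by ring)
  have hD : HasDerivAt (fun s => Complex.normSq (ζ s)) (τ * Complex.normSq (ζ s)) s :=
    (hasDerivAt_normSq hζ).congr_deriv (by rw [re_conj_mul_real_smul]; ring)
  have hM : HasDerivAt (fun s => Complex.normSq (w s)) (τ * Complex.normSq (w s)) s :=
    (hasDerivAt_normSq hw).congr_deriv (by rw [re_conj_mul_real_smul]; ring)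
  have hs := Real.sqrt_pos.2 h0
  have hss := Real.mul_self_sqrt h0.le
  have hρ : τ * N s / (2 * Real.sqrt (N s)) = τ / 2 * Real.sqrt (N s) := by
    rw [div_eq_iff (by positivity)]
    linear_combination (-τ) * hss
  have hX : HasDerivAt (fun s => Real.sqrt (N s) * (e s ^ k * ζ s).re)
      (τ * (Real.sqrt (N s) * (e s ^ k * ζ s).re)) s :=
    (hasDerivAt_sqrt_mul_re hN hZ h0).congr_deriv (by
      rw [hρ, Complex.re_ofReal_mul]; ring)
  have hY : HasDerivAt (fun s => Real.sqrt (N s) * (e s ^ k * ζ s).im)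
      (τ * (Real.sqrt (N s) * (e s ^ k * ζ s).im)) s :=
    (hasDerivAt_sqrt_mul_im hN hZ h0).congr_deriv (by
      rw [hρ, Complex.im_ofReal_mul]; ring)
  have hS := (hN.add hD).div_const 2
  have hC := hN.sub hD
  have hre := hasDerivAt_re he
  have him := hasDerivAt_im he
  have h1 := (hS.const_mul (Real.cosh b)).sub (hX.const_mul (Real.sinh b))
  have h2 := (hX.const_mul (Real.cosh b)).sub (hS.const_mul (Real.sinh b))
  have h3 := ((h1.sub (hC.div_const 2)).sub hM).add
    ((((h1.const_mul (Real.cosh b)).add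
      (((hre.mul h2).sub (him.mul hY)).const_mul (Real.sinh b))).add (hC.div_const 2)).const_mul δ)
  refine h3.congr_deriv ?_
  simp only [boostQuad, boostForm, Complex.zero_re, Complex.zero_im, Pi.add_apply, Pi.sub_apply]
  ring

/-- The differential of `boostHam`. -/
lemma fderiv_boostHam (k : ℕ) (a b : ℝ) (j : Fin n) {p : Amb n} (hp : nsq p ≠ 0) (w : Amb n) :
    fderiv ℝ (boostHam k a b j) p w =
      a / 2 * (w.2.re * (Real.sqrt (nsq p) * (p.2 ^ k * zc j p).im)
        + (p.2.re - 1) * ((⟪p.1.1, w.1.1⟫_ℝ + ⟪p.1.2, w.1.2⟫_ℝ) / Real.sqrt (nsq p)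
            * (p.2 ^ k * zc j p).im
          + Real.sqrt (nsq p) * (p.2 ^ k * zc j w + k * p.2 ^ (k - 1) * w.2 * zc j p).im)
        + w.2.im * (Real.cosh b * (Real.sqrt (nsq p) * (p.2 ^ k * zc j p).re)
          - Real.sinh b * ((nsq p + Complex.normSq (zc j p)) / 2))
        + p.2.im * (Real.cosh b * ((⟪p.1.1, w.1.1⟫_ℝ + ⟪p.1.2, w.1.2⟫_ℝ) / Real.sqrt (nsq p)
            * (p.2 ^ k * zc j p).re
          + Real.sqrt (nsq p) * (p.2 ^ k * zc j w + k * p.2 ^ (k - 1) * w.2 * zc j p).re)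
          - Real.sinh b * ((⟪p.1.1, w.1.1⟫_ℝ + ⟪p.1.2, w.1.2⟫_ℝ)
            + (conj (zc j p) * zc j w).re))) := by
  -- differentiate along the line through `p` in the direction `w`
  have hl : HasDerivAt (fun t : ℝ => p + t • w) w 0 := by
    simpa using ((hasDerivAt_id (0 : ℝ)).smul_const w).const_add p
  have hN0 : 0 < nsq p := lt_of_le_of_ne (nsq_nonneg _) hp.symm
  have hN : HasDerivAt (fun t : ℝ => nsq (p + t • w))
      (2 * (⟪p.1.1, w.1.1⟫_ℝ + ⟪p.1.2, w.1.2⟫_ℝ)) 0 := by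
    have h1 : HasDerivAt (fun t : ℝ => (p + t • w).1.1) w.1.1 0 := hl.fst.fst
    have h2 : HasDerivAt (fun t : ℝ => (p + t • w).1.2) w.1.2 0 := hl.fst.snd
    refine ((HasDerivAt.norm_sq h1).add (HasDerivAt.norm_sq h2)).congr_deriv ?_
    simp
    ring
  have he : HasDerivAt (fun t : ℝ => (p + t • w).2) w.2 0 := hl.snd
  have hz : HasDerivAt (fun t : ℝ => zc j (p + t • w)) (zc j w) 0 :=
    (zc j).hasFDerivAt.comp_hasDerivAt (0 : ℝ) hl
  have hZ : HasDerivAt (fun t : ℝ => (p + t • w).2 ^ k * zc j (p + t • w))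
      (p.2 ^ k * zc j w + k * p.2 ^ (k - 1) * w.2 * zc j p) 0 := by
    refine ((he.pow k).mul hz).congr_deriv ?_
    simp
    ring
  have hN0' : 0 < nsq (p + (0 : ℝ) • w) := by simpa using hN0
  have hX := hasDerivAt_sqrt_mul_re hN hZ hN0'
  have hY := hasDerivAt_sqrt_mul_im hN hZ hN0'
  have hD := hasDerivAt_normSq hz
  have hline := ((((hasDerivAt_re he).sub_const 1).mul hY).add ((hasDerivAt_im he).mul
    ((hX.const_mul (Real.cosh b)).sub
      (((hN.add hD).div_const 2).const_mul (Real.sinh b))))).const_mul (a / 2)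
  have hdiff : DifferentiableAt ℝ (boostHam k a b j) p := by
    have e1 : DifferentiableAt ℝ (fun p : Amb n => p.2) p := differentiableAt_snd
    have e2 : DifferentiableAt ℝ (fun p : Amb n => p.2.re) p :=
      Complex.reCLM.differentiableAt.comp p e1
    have e3 : DifferentiableAt ℝ (fun p : Amb n => p.2.im) p :=
      Complex.imCLM.differentiableAt.comp p e1
    have e4 : DifferentiableAt ℝ (nsq (n := n)) p := contDiff_nsq.differentiable (by simp) p
    have e5 : DifferentiableAt ℝ (fun p : Amb n => p.2 ^ k * zc j p) p :=
      (e1.pow k).mul (zc j).differentiableAt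
    have e6 := Complex.reCLM.differentiableAt.comp p e5
    have e7 := Complex.imCLM.differentiableAt.comp p e5
    have e8 : DifferentiableAt ℝ (fun p : Amb n => Complex.normSq (zc j p)) p := by
      have r1 := Complex.reCLM.differentiableAt.comp p (zc j).differentiableAt
      have r2 := Complex.imCLM.differentiableAt.comp p (zc j).differentiableAt
      exact (r1.mul r1).add (r2.mul r2)
    have e9 := e4.sqrt hp
    have e10 : DifferentiableAt ℝ
        (fun p : Amb n => (nsq p + Complex.normSq (zc j p)) / 2) p := by
      simp only [div_eq_mul_inv]
      exact (e4.add e8).mul_const (2 : ℝ)⁻¹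
    exact (((e2.sub_const 1).mul (e9.mul e7)).add (e3.mul (((e9.mul e6).const_mul _).sub
      (e10.const_mul _)))).const_mul _
  have hdiff' : HasFDerivAt (boostHam k a b j) (fderiv ℝ (boostHam k a b j) p)
      (p + (0 : ℝ) • w) := by simpa using hdiff.hasFDerivAt
  have hline' : HasDerivAt (fun t : ℝ => boostHam k a b j (p + t • w)) _ 0 := hline
  have h1 := (HasFDerivAt.comp_hasDerivAt (f := fun t : ℝ => p + t • w) (0 : ℝ) hdiff' hl).unique
    hline'
  rw [h1]
  have hs := (Real.sqrt_pos.2 hN0).ne'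
  simp only [zero_smul, add_zero, Pi.add_apply, Pi.sub_apply]
  field_simp
  ring

/-- The transport equation for `boostForm`. Up to the conformal factor `τ`, the contact flow of
`boostHam` moves `(N, ζ)` by infinitesimal boosts, with coefficients `α`, `β`, `γ`, so that `S`,
`X`, `Y` satisfy a linear system and `C`, `M` are only rescaled. -/
lemma boostForm_transport (κ : ℝ) (k : ℕ) (δ a : ℝ) {i j : Fin n}
    (hij : i ≠ j) (s : ℝ) (p : ℝ → Amb n) (hp : ‖(p s).2‖ = 1) (hN : nsq (p s) ≠ 0) (hκ : κ = k)
    (hd : HasDerivAt p (contactField (boostHam k a (a * s) j) (p s)) s) :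
    HasDerivAt (fun s => κ * nsq (p s)
        + boostQuad k δ (a * s) (nsq (p s)) (zc j (p s)) (zc i (p s)) (p s).2)
      (angDeriv (boostHam k a (a * s) j) (p s) * (κ * nsq (p s)
          + boostQuad k δ (a * s) (nsq (p s)) (zc j (p s)) (zc i (p s)) (p s).2)
        - angDeriv (boostHam k a (a * s) j) (p s) / Real.pi) s := by
  obtain ⟨hz, hnsq, he⟩ := hasDerivAt_coords hd
  set b : ℝ := a * s with hb
  set τ : ℝ := angDeriv (boostHam k a b j) (p s) with hτ
  set e := (p s).2 with he_def
  set N := nsq (p s) with hN_def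
  set ρ := Real.sqrt N with hρ
  set ζ := zc j (p s) with hζ_def
  set Z := e ^ k * ζ with hZ_def
  have hN0 : 0 < N := lt_of_le_of_ne (nsq_nonneg _) (Ne.symm hN)
  have hρ0 : 0 < ρ := Real.sqrt_pos.2 hN0
  have hρρ : ρ * ρ = N := Real.mul_self_sqrt hN0.le
  have hpi := Real.pi_ne_zero
  set c := Real.cosh b with hc
  set σ := Real.sinh b with hσ
  have hcs : c ^ 2 - σ ^ 2 = 1 := Real.cosh_sq_sub_sinh_sq b
  have hee : e.re ^ 2 + e.im ^ 2 = 1 := by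
    have := Complex.normSq_eq_norm_sq e
    rw [Complex.normSq_apply, hp] at this
    linarith
  -- the gradient of the Hamiltonian consists of a radial part `μ` and a part in the coordinate `j`
  set α : ℝ := -a * e.im * σ with hα
  set β : ℝ := a * e.im * c with hβ
  set γ : ℝ := a * (e.re - 1) with hγ
  set μ : ℝ := (α + (β * Z.re + γ * Z.im) / ρ) / 2 with hμ
  have hEE : e ^ k * conj (e ^ k) = 1 := by
    rw [Complex.mul_conj, Complex.normSq_eq_norm_sq, norm_pow, hp]; norm_num
  have hDZ : Complex.normSq ζ = Z.re ^ 2 + Z.im ^ 2 := by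
    have : Complex.normSq Z = Complex.normSq ζ := by
      rw [hZ_def, Complex.normSq_mul, Complex.normSq_eq_norm_sq (e ^ k), norm_pow, hp]; simp
    rw [← this, Complex.normSq_apply]; ring
  have hzi' : HasDerivAt (fun s => zc i (p s))
      (Complex.I * μ * zc i (p s) + (τ / 2 : ℝ) * zc i (p s)) s := by
    refine (hz i).congr_deriv ?_
    rw [fderiv_boostHam _ _ _ _ hN, fderiv_boostHam _ _ _ _ hN, zc_single_fst, zc_single_snd]
    simp only [hij.symm, if_false]
    apply Complex.ext <;> simp [EuclideanSpace.inner_single_right, ← he_def, ← hN_def,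
      ← hρ, ← hζ_def, ← hZ_def, ← hc, ← hσ, hμ, hα, hβ, hγ] <;> ring
  have hζ' : HasDerivAt (fun s => zc j (p s))
      (Complex.I * ((μ + α / 2 : ℝ) * ζ + (ρ / 2 : ℝ) * ((β : ℂ) + γ * Complex.I) * conj (e ^ k))
        + (τ / 2 : ℝ) * ζ) s := by
    refine (hz j).congr_deriv ?_
    rw [fderiv_boostHam _ _ _ _ hN, fderiv_boostHam _ _ _ _ hN, zc_single_fst, zc_single_snd]
    simp only [if_true]
    have hx : (p s).1.1 j = ζ.re := (zc_re j (p s)).symm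
    have hy : (p s).1.2 j = ζ.im := (zc_im j (p s)).symm
    apply Complex.ext <;> simp [-map_pow, EuclideanSpace.inner_single_right, ← he_def, ← hN_def,
      ← hρ, ← hζ_def, ← hZ_def, ← hc, ← hσ, hμ, hα, hβ, hγ, hx, hy] <;> ring
  have hN' : HasDerivAt (fun s => nsq (p s))
      (ρ * (β * Z.im - γ * Z.re) + τ * N) s := by
    refine hnsq.congr_deriv ?_
    have h1 : zc j (((p s).1.2, -(p s).1.1), (0 : ℂ)) = -Complex.I * ζ :=
      zc_symplectic_rotation j (p s)
    have h2 : e ^ k * (-Complex.I * ζ) + k * e ^ (k - 1) * 0 * ζ = -Complex.I * Z := by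
      rw [hZ_def]; ring
    have h3 : (conj ζ * (-Complex.I * ζ)).re = 0 := by
      simp; ring
    rw [fderiv_boostHam _ _ _ _ hN, h1]
    simp only [← he_def, ← hζ_def, h2, h3]
    simp [real_inner_comm, ← hN_def, ← hρ, ← hZ_def, ← hc, ← hσ, hβ, hγ]
    ring
  have he' : HasDerivAt (fun s => (p s).2) 0 s := by
    refine he ?_
    have h1 : zc j ((p s).1, (0 : ℂ)) = ζ := zc_horizontal j (p s)
    have h3 : (conj ζ * ζ).re = Complex.normSq ζ := by
      rw [← Complex.normSq_eq_conj_mul_self, Complex.ofReal_re]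
    have h4 : ⟪(p s).1.1, (p s).1.1⟫_ℝ + ⟪(p s).1.2, (p s).1.2⟫_ℝ = N := by
      rw [real_inner_self_eq_norm_sq, real_inner_self_eq_norm_sq]; rfl
    have h5 : N / ρ = ρ := by rw [← hρρ]; field_simp
    rw [fderiv_boostHam _ _ _ _ hN, h1]
    simp only [← he_def, ← hζ_def, h3, h4, ← hN_def, ← hρ, h5, ← hZ_def, ← hc, ← hσ, boostHam]
    simp
    ring
  have hτ' : τ = a * Real.pi * (k * (e.re - 1) * (ρ * Z.re) - e.im * (ρ * Z.im)
      + e.re * (c * (ρ * Z.re) - σ * ((N + Complex.normSq ζ) / 2))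
      - k * e.im * c * (ρ * Z.im)) := by
    have hke : (k : ℂ) * e ^ (k - 1) * e = k * e ^ k := by
      rcases Nat.eq_zero_or_pos k with h | h
      · simp [h]
      · rw [mul_assoc, ← pow_succ, Nat.sub_add_cancel h]
    have h2 : e ^ k * 0 + k * e ^ (k - 1) * (((2 * Real.pi : ℝ) : ℂ) * Complex.I * e) * ζ
        = ((2 * Real.pi * k : ℝ) : ℂ) * (Complex.I * Z) := by
      rw [hZ_def]; push_cast
      linear_combination (2 * Real.pi * Complex.I * ζ) * hke
    rw [hτ, angDeriv, fderiv_boostHam _ _ _ _ hN, zc_vertical]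
    simp only [← he_def, ← hζ_def, h2, ← hN_def, ← hρ, ← hZ_def, ← hc, ← hσ]
    simp
    ring
  have hek : HasDerivAt (fun s => (p s).2 ^ k) 0 s := (he'.pow k).congr_deriv (by simp)
  have hZ' : HasDerivAt (fun s => (p s).2 ^ k * zc j (p s))
      (Complex.I * ((μ + α / 2 : ℝ) * Z + (ρ / 2 : ℝ) * ((β : ℂ) + γ * Complex.I))
        + (τ / 2 : ℝ) * Z) s := by
    refine (hek.mul hζ').congr_deriv ?_
    rw [← he_def, ← hζ_def, hZ_def]
    linear_combination (Complex.I * ((ρ / 2 : ℝ) * ((β : ℂ) + γ * Complex.I))) * hEE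
  have hD : HasDerivAt (fun s => Complex.normSq (zc j (p s)))
      (ρ * (β * Z.im - γ * Z.re) + τ * Complex.normSq ζ) s := by
    have h1 : conj ζ * (Complex.I * ((μ + α / 2 : ℝ) * ζ
        + (ρ / 2 : ℝ) * ((β : ℂ) + γ * Complex.I) * conj (e ^ k)) + (τ / 2 : ℝ) * ζ)
        = ((τ / 2 * Complex.normSq ζ : ℝ) : ℂ)
          + Complex.I * ((((μ + α / 2) * Complex.normSq ζ : ℝ) : ℂ)
            + (ρ / 2 : ℝ) * (((β : ℂ) + γ * Complex.I) * conj Z)) := by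
      rw [hZ_def, map_mul]
      push_cast
      rw [Complex.normSq_eq_conj_mul_self]
      ring
    refine (hasDerivAt_normSq hζ').congr_deriv ?_
    rw [← hζ_def, h1]
    simp
    ring
  have hM : HasDerivAt (fun s => Complex.normSq (zc i (p s)))
      (τ * Complex.normSq (zc i (p s))) s := by
    have h1 : conj (zc i (p s)) * (Complex.I * μ * zc i (p s) + (τ / 2 : ℝ) * zc i (p s))
        = ((τ / 2 * Complex.normSq (zc i (p s)) : ℝ) : ℂ)
          + Complex.I * ((μ * Complex.normSq (zc i (p s)) : ℝ) : ℂ) := by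
      push_cast
      rw [Complex.normSq_eq_conj_mul_self]
      ring
    refine (hasDerivAt_normSq hzi').congr_deriv ?_
    rw [h1]
    simp
    ring
  have hX : HasDerivAt (fun s => Real.sqrt (nsq (p s)) * ((p s).2 ^ k * zc j (p s)).re)
      (-α * (ρ * Z.im) - γ * ((N + Complex.normSq ζ) / 2) + τ * (ρ * Z.re)) s := by
    refine (hasDerivAt_sqrt_mul_re hN' hZ' hN0).congr_deriv ?_
    rw [← hN_def, ← hρ, ← he_def, ← hζ_def, ← hZ_def, hDZ, hμ, ← hρρ]
    simp
    field_simp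
    ring
  have hY : HasDerivAt (fun s => Real.sqrt (nsq (p s)) * ((p s).2 ^ k * zc j (p s)).im)
      (α * (ρ * Z.re) + β * ((N + Complex.normSq ζ) / 2) + τ * (ρ * Z.im)) s := by
    refine (hasDerivAt_sqrt_mul_im hN' hZ' hN0).congr_deriv ?_
    rw [← hN_def, ← hρ, ← he_def, ← hζ_def, ← hZ_def, hDZ, hμ, ← hρρ]
    simp
    field_simp
    ring
  -- what remains is an identity in `S`, `X`, `Y`, by `cosh² - sinh² = 1` and `|e|² = 1`
  have hbd : HasDerivAt (fun s => a * s) a s := by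
    simpa using (hasDerivAt_id s).const_mul a
  have hch := hbd.cosh
  have hsh := hbd.sinh
  have hS := (hN'.add hD).div_const 2
  have hC := hN'.sub hD
  have hre := hasDerivAt_re he'
  have him := hasDerivAt_im he'
  have h1 := (hch.mul hS).sub (hsh.mul hX)
  have h2 := (hch.mul hX).sub (hsh.mul hS)
  have h3 := ((h1.sub (hC.div_const 2)).sub hM).add
    ((((hch.mul h1).add (hsh.mul ((hre.mul h2).sub (him.mul hY)))).add
      (hC.div_const 2)).const_mul δ)
  have h4 := (hN'.const_mul κ).add h3
  have e3 : τ / Real.pi = a * (k * (e.re - 1) * (ρ * Z.re) - e.im * (ρ * Z.im)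
      + e.re * (c * (ρ * Z.re) - σ * ((N + Complex.normSq ζ) / 2))
      - k * e.im * c * (ρ * Z.im)) := by
    rw [hτ']; field_simp
  refine h4.congr_deriv ?_
  rw [e3, hκ]
  simp only [boostQuad, boostForm, Complex.zero_re, Complex.zero_im, Pi.add_apply, Pi.sub_apply,
    Pi.mul_apply, ← hb, ← he_def, ← hζ_def, ← hN_def, ← hρ, ← hZ_def, ← hc, ← hσ]
  rw [hα, hβ, hγ]
  linear_combination (a * e.im * (ρ * Z.im) * (1 + δ * c)) * hcs
    - δ * a * σ * (c * ((N + Complex.normSq ζ) / 2) - σ * (ρ * Z.re)) * hee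

lemma continuous_boostQuad {X : Type*} [TopologicalSpace X] (k : ℕ) (δ : ℝ) {b N : X → ℝ}
    {ζ w e : X → ℂ} (hb : Continuous b) (hN : Continuous N) (hζ : Continuous ζ) (hw : Continuous w)
    (he : Continuous e) : Continuous fun x => boostQuad k δ (b x) (N x) (ζ x) (w x) (e x) := by
  have h1 : Continuous fun x => (e x ^ k * ζ x).re :=
    Complex.continuous_re.comp ((he.pow k).mul hζ)
  have h2 : Continuous fun x => (e x ^ k * ζ x).im :=
    Complex.continuous_im.comp ((he.pow k).mul hζ)
  have h3 : Continuous fun x => Complex.normSq (ζ x) := Complex.continuous_normSq.comp hζ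
  have h4 : Continuous fun x => Complex.normSq (w x) := Complex.continuous_normSq.comp hw
  have h5 : Continuous fun x => Real.cosh (b x) := Real.continuous_cosh.comp hb
  have h6 : Continuous fun x => Real.sinh (b x) := Real.continuous_sinh.comp hb
  have h7 : Continuous fun x => (e x).re := Complex.continuous_re.comp he
  have h8 : Continuous fun x => (e x).im := Complex.continuous_im.comp he
  unfold boostQuad boostForm
  fun_prop

lemma contDiffAt_boostHam (k : ℕ) (a : ℝ) (j : Fin n) {r : ℝ × Amb n} (hr : nsq r.2 ≠ 0) :
    ContDiffAt ℝ ∞ (Function.uncurry fun s => boostHam k a (a * s) j) r := by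
  have e1 : ContDiffAt ℝ ∞ (fun r : ℝ × Amb n => r.2.2) r :=
    (contDiff_snd.comp contDiff_snd).contDiffAt
  have e2 : ContDiffAt ℝ ∞ (fun r : ℝ × Amb n => r.2.2.re) r :=
    Complex.reCLM.contDiff.contDiffAt.comp r e1
  have e3 : ContDiffAt ℝ ∞ (fun r : ℝ × Amb n => r.2.2.im) r :=
    Complex.imCLM.contDiff.contDiffAt.comp r e1
  have e4 : ContDiffAt ℝ ∞ (fun r : ℝ × Amb n => nsq r.2) r :=
    (contDiff_nsq.comp contDiff_snd).contDiffAt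
  have e0 : ContDiffAt ℝ ∞ (fun r : ℝ × Amb n => zc j r.2) r :=
    ((zc j).contDiff.comp contDiff_snd).contDiffAt
  have e5 : ContDiffAt ℝ ∞ (fun r : ℝ × Amb n => r.2.2 ^ k * zc j r.2) r := (e1.pow k).mul e0
  have e6 := Complex.reCLM.contDiff.contDiffAt.comp r e5
  have e7 := Complex.imCLM.contDiff.contDiffAt.comp r e5
  have e8 : ContDiffAt ℝ ∞ (fun r : ℝ × Amb n => Complex.normSq (zc j r.2)) r := by
    have r1 := Complex.reCLM.contDiff.contDiffAt.comp r e0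
    have r2 := Complex.imCLM.contDiff.contDiffAt.comp r e0
    exact (r1.mul r1).add (r2.mul r2)
  have e9 := e4.sqrt hr
  have e10 : ContDiffAt ℝ ∞
      (fun r : ℝ × Amb n => (nsq r.2 + Complex.normSq (zc j r.2)) / 2) r :=
    (e4.add e8).div_const 2
  have e11 : ContDiffAt ℝ ∞ (fun r : ℝ × Amb n => a * r.1) r :=
    (contDiff_const.mul contDiff_fst).contDiffAt
  have e12 := Real.contDiff_cosh.contDiffAt.comp r e11
  have e13 := Real.contDiff_sinh.contDiffAt.comp r e11
  exact contDiffAt_const.mul (((e2.sub contDiffAt_const).mul (e9.mul e7)).add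
    (e3.mul ((e12.mul (e9.mul e6)).sub (e13.mul e10))))

/-- Contact isotopies realising the conjugation of a loop of rotations by boosts. -/
theorem exists_boost_isotopy {δ L Λ c : ℝ} (k : ℕ) (a : ℝ) {i j : Fin n}
    (hij : i ≠ j) (hL : 0 < L) (hc : 1 / (Real.pi * L) < c)
    (hlow : ∀ s ∈ Icc (0 : ℝ) 1, ∀ p : Amb n, ‖p.2‖ = 1 →
      L * nsq p ≤ k * nsq p + boostQuad k δ (a * s) (nsq p) (zc j p) (zc i p) p.2)
    (hupp : ∀ s ∈ Icc (0 : ℝ) 1, ∀ p : Amb n, ‖p.2‖ = 1 →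
      k * nsq p + boostQuad k δ (a * s) (nsq p) (zc j p) (zc i p) p.2 ≤ Λ * nsq p) :
    ∃ φ : ℝ → V n ≃ₘ^∞⟮model n, model n⟯ V n, IsContactIsotopy φ ∧
      (∀ p, c < nsq (incl p) → ∀ s, φ s p = p) ∧
      (∀ p, Real.pi * (k * nsq (incl p) + boostQuad k δ 0 (nsq (incl p)) (zc j (incl p))
          (zc i (incl p)) (incl p).2) ≤ 1 →
        Real.pi * (k * nsq (incl (φ 1 p)) + boostQuad k δ a (nsq (incl (φ 1 p)))
          (zc j (incl (φ 1 p))) (zc i (incl (φ 1 p))) (incl (φ 1 p)).2) ≤ 1) := by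
  have hq : Continuous (Function.uncurry fun (s : ℝ) (p : Amb n) =>
      k * nsq p + boostQuad k δ (a * s) (nsq p) (zc j p) (zc i p) p.2) := by
    have hN : Continuous fun q : ℝ × Amb n => nsq q.2 := contDiff_nsq.continuous.comp continuous_snd
    have hzi : Continuous fun q : ℝ × Amb n => zc i q.2 := (zc i).continuous.comp continuous_snd
    have hzj : Continuous fun q : ℝ × Amb n => zc j q.2 := (zc j).continuous.comp continuous_snd
    have he : Continuous fun q : ℝ × Amb n => q.2.2 := continuous_snd.comp continuous_snd
    have ha : Continuous fun q : ℝ × Amb n => a * q.1 := by fun_prop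
    exact (continuous_const.mul hN).add (continuous_boostQuad k δ ha hN hzj hzi he)
  have hk : ∀ r : ℝ × Amb n, nsq r.2 ≠ 0 →
      ContDiffAt ℝ ∞ (Function.uncurry fun s => boostHam k a (a * s) j) r :=
    fun r hr => contDiffAt_boostHam k a j hr
  obtain ⟨φ, h1, h2, h3⟩ := exists_transport_of_bounds (k := fun s => boostHam k a (a * s) j)
    (q := fun s p => k * nsq p + boostQuad k δ (a * s) (nsq p) (zc j p) (zc i p) p.2)
    hL hc hk hq hlow hupp
    (fun s p hp hN hd => boostForm_transport (k : ℝ) k δ a hij s p hp hN rfl hd)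
  refine ⟨φ, h1, h2, fun p hp => ?_⟩
  have h4 := h3 p (by rw [mul_zero]; exact hp)
  rwa [mul_one] at h4

/-! ### Estimates for boosted quadratic functions -/

/-- The reversed Cauchy-Schwarz inequality for `u² - v²` and `S² - X²`. -/
lemma half_mul_le_of_timelike {u v μ S X C : ℝ} (hu : 0 ≤ u) (hμ : 0 ≤ μ)
    (huv : μ ^ 2 ≤ u ^ 2 - v ^ 2) (hS : 0 ≤ S) (hC : 0 ≤ C) (hSX : C ^ 2 / 4 ≤ S ^ 2 - X ^ 2) :
    μ * C / 2 ≤ u * S + v * X := by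
  have h1 : |v| ≤ u := abs_le_of_sq_le_sq (by nlinarith [sq_nonneg μ]) hu
  have h2 : |X| ≤ S := abs_le_of_sq_le_sq (by nlinarith [sq_nonneg C]) hS
  have h3 : 0 ≤ u * S + v * X := by
    have h4 : |v| * |X| ≤ u * S := mul_le_mul h1 h2 (abs_nonneg X) hu
    rw [← abs_mul] at h4
    linarith [neg_abs_le (v * X)]
  have h5 : μ ^ 2 * (C ^ 2 / 4) ≤ (u ^ 2 - v ^ 2) * (S ^ 2 - X ^ 2) :=
    mul_le_mul huv hSX (by positivity) ((sq_nonneg μ).trans huv)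
  refine (pow_le_pow_iff_left₀ (by positivity) h3 two_ne_zero).1 ?_
  nlinarith [sq_nonneg (u * X + v * S)]

lemma pos_of_timelike {u v S X : ℝ} (hu : 0 ≤ u) (huv : 0 < u ^ 2 - v ^ 2) (hS : 0 < S)
    (hSX : 0 ≤ S ^ 2 - X ^ 2) : 0 < u * S + v * X := by
  have h1 : |v| < u := abs_lt_of_sq_lt_sq (by linarith) hu
  have h2 : |X| ≤ S := abs_le_of_sq_le_sq (by linarith) hS.le
  have h4 : |v| * |X| < u * S := by nlinarith [abs_nonneg v, abs_nonneg X]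
  rw [← abs_mul] at h4
  linarith [neg_abs_le (v * X)]

/-- The relations between `N` and the arguments of `boostForm`: `M` is the squared modulus of a
second coordinate, so that `|ζ|² + M ≤ N`, and the last relation is the Casimir relation of `sl(2, ℝ)`. -/
structure IsAdmissible (N S C X Y M : ℝ) : Prop where
  M_nonneg : 0 ≤ M
  M_le : M ≤ C
  C_le : C ≤ N
  S_eq : S = N - C / 2
  sq_eq : S ^ 2 - X ^ 2 - Y ^ 2 = C ^ 2 / 4

lemma isAdmissible_coords (k : ℕ) {N : ℝ} {ζ w e : ℂ} (he : ‖e‖ = 1)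
    (h : Complex.normSq ζ + Complex.normSq w ≤ N) :
    IsAdmissible N ((N + Complex.normSq ζ) / 2) (N - Complex.normSq ζ)
      (Real.sqrt N * (e ^ k * ζ).re) (Real.sqrt N * (e ^ k * ζ).im) (Complex.normSq w) := by
  have h1 := Complex.normSq_nonneg ζ
  have h2 := Complex.normSq_nonneg w
  have h3 : Real.sqrt N ^ 2 = N := Real.sq_sqrt (by linarith)
  have h4 : (e ^ k * ζ).re ^ 2 + (e ^ k * ζ).im ^ 2 = Complex.normSq ζ := by
    have h5 : Complex.normSq (e ^ k * ζ) = Complex.normSq ζ := by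
      rw [Complex.normSq_mul, Complex.normSq_eq_norm_sq (e ^ k), norm_pow, he]; simp
    rw [← h5, Complex.normSq_apply]; ring
  refine ⟨h2, by linarith, by linarith, by ring, ?_⟩
  rw [mul_pow, mul_pow, h3]
  linear_combination (-N) * h4

lemma IsAdmissible.C_nonneg {N S C X Y M : ℝ} (h : IsAdmissible N S C X Y M) :
    0 ≤ C := h.M_nonneg.trans h.M_le

lemma IsAdmissible.S_nonneg {N S C X Y M : ℝ} (h : IsAdmissible N S C X Y M) : 0 ≤ S := by
  have := h.C_nonneg
  have := h.C_le
  rw [h.S_eq]; linarith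

lemma IsAdmissible.sq_sub_le {N S C X Y M : ℝ} (h : IsAdmissible N S C X Y M) :
    C ^ 2 / 4 ≤ S ^ 2 - X ^ 2 := by
  rw [← h.sq_eq]; nlinarith [sq_nonneg Y]

lemma IsAdmissible.le_boost {N S C X Y M : ℝ} (h : IsAdmissible N S C X Y M)
    (b : ℝ) : C / 2 ≤ Real.cosh b * S - Real.sinh b * X := by
  have := half_mul_le_of_timelike (u := Real.cosh b) (v := -Real.sinh b) (μ := 1)
    (Real.cosh_pos b).le zero_le_one (by nlinarith [Real.cosh_sq_sub_sinh_sq b]) h.S_nonneg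
    h.C_nonneg h.sq_sub_le
  linarith

lemma IsAdmissible.le_boost_boost {N S C X Y M : ℝ} (h : IsAdmissible N S C X Y M)
    (b : ℝ) {e : ℂ} (he : ‖e‖ = 1) :
    C / 2 ≤ Real.cosh b * (Real.cosh b * S - Real.sinh b * X)
      + Real.sinh b * (e.re * (Real.cosh b * X - Real.sinh b * S) - e.im * Y) := by
  have h1 := Real.cosh_sq_sub_sinh_sq b
  have h2 : e.re ^ 2 + e.im ^ 2 = 1 := by
    have := Complex.normSq_eq_norm_sq e
    rw [Complex.normSq_apply, he] at this
    linarith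
  set S' := Real.cosh b * S - Real.sinh b * X with hS'
  set X' := Real.cosh b * X - Real.sinh b * S with hX'
  have h3 : S' ^ 2 - X' ^ 2 = S ^ 2 - X ^ 2 := by
    rw [hS', hX']
    linear_combination (S ^ 2 - X ^ 2) * h1
  have h4 : C ^ 2 / 4 ≤ S' ^ 2 - (e.re * X' - e.im * Y) ^ 2 := by
    have h5 : S' ^ 2 - (e.re * X' - e.im * Y) ^ 2 = C ^ 2 / 4 + (e.im * X' + e.re * Y) ^ 2 := by
      linear_combination h3 + h.sq_eq - (X' ^ 2 + Y ^ 2) * h2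
    rw [h5]
    linarith [sq_nonneg (e.im * X' + e.re * Y)]
  have h6 : 0 ≤ S' := by linarith [h.le_boost b, h.C_nonneg]
  have := half_mul_le_of_timelike (u := Real.cosh b) (v := Real.sinh b) (μ := 1)
    (Real.cosh_pos b).le zero_le_one (by linarith) h6 h.C_nonneg h4
  linarith

/-- The lower bound for the boosts of the loop of rotations. -/
lemma IsAdmissible.boostForm_ge {N S C X Y M : ℝ} (h : IsAdmissible N S C X Y M)
    {δ : ℝ} (h0 : 0 ≤ δ) (h1 : δ ≤ 1) (b : ℝ) {e : ℂ} (he : ‖e‖ = 1) :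
    (δ - 1) * N ≤ boostForm δ b e S C X Y M := by
  have h2 := h.le_boost b
  have h3 := mul_le_mul_of_nonneg_left (h.le_boost_boost b he) h0
  have h4 := h.C_le
  have h5 := h.M_le
  unfold boostForm
  nlinarith

/-- The lower bound during the contraction of the loop of rotations after a large boost. -/
lemma IsAdmissible.boostForm_sub_ge {N S C X Y M : ℝ} (h : IsAdmissible N S C X Y M)
    {δ ε b : ℝ} (h0 : 0 ≤ δ) (h1 : δ ≤ 1) (hε : 0 ≤ ε)
    (hb : 9 ≤ 1 + ε ^ 2 + 2 * ε * Real.cosh b) {e : ℂ} (he : ‖e‖ = 1) :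
    (δ - 1 - ε) * N ≤ boostForm δ b e S C X Y M - M := by
  have h2 := half_mul_le_of_timelike (u := Real.cosh b + ε) (v := -Real.sinh b) (μ := 3)
    (by linarith [Real.cosh_pos b]) (by norm_num) (by nlinarith [Real.cosh_sq_sub_sinh_sq b])
    h.S_nonneg h.C_nonneg h.sq_sub_le
  have h3 := mul_le_mul_of_nonneg_left (h.le_boost_boost b he) h0
  have h4 := h.C_le
  have h5 := h.M_le
  have h6 : ε * S ≤ ε * N := by
    have := h.C_nonneg
    exact mul_le_mul_of_nonneg_left (by rw [h.S_eq]; linarith) hε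
  have h7 : 0 ≤ (1 - δ) * (N - C) := mul_nonneg (by linarith) (by linarith)
  unfold boostForm
  nlinarith

/-- The strict lower bound at the end of the contraction of the loop of rotations after a large
boost. -/
lemma IsAdmissible.boostForm_gt {N S C X Y M : ℝ} (h : IsAdmissible N S C X Y M)
    {δ b : ℝ} (h0 : 0 ≤ δ) (h1 : δ ≤ 1)
    (hb : 49 ≤ 1 + (1 - δ) ^ 2 + 2 * (1 - δ) * Real.cosh b) {e : ℂ} (he : ‖e‖ = 1) (hN : 0 < N) :
    δ * N < boostForm δ b e S C X Y M + (N - C) - M := by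
  have h8 : 7 ^ 2 ≤ (Real.cosh b + (1 - δ)) ^ 2 - (-Real.sinh b) ^ 2 := by
    nlinarith [Real.cosh_sq_sub_sinh_sq b]
  have hu : 0 ≤ Real.cosh b + (1 - δ) := by linarith [Real.cosh_pos b]
  have h2 := half_mul_le_of_timelike (u := Real.cosh b + (1 - δ)) (v := -Real.sinh b) (μ := 7)
    hu (by norm_num) h8 h.S_nonneg h.C_nonneg h.sq_sub_le
  have h3 := mul_le_mul_of_nonneg_left (h.le_boost_boost b he) h0
  have h4 := h.C_le
  have h5 := h.M_le
  have hC := h.C_nonneg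
  have hS := h.S_eq
  have hkey : (6 - δ) * C / 2 < (Real.cosh b + (1 - δ)) * S + -Real.sinh b * X := by
    rcases hC.eq_or_lt with hC0 | hC0
    · have := pos_of_timelike (v := -Real.sinh b) hu (by linarith)
        (show 0 < S by rw [hS]; linarith) ((by positivity : (0 : ℝ) ≤ C ^ 2 / 4).trans h.sq_sub_le)
      rw [← hC0]
      linarith
    · nlinarith
  unfold boostForm
  subst hS
  nlinarith

/-- A crude upper bound, uniform in the rapidity. -/
lemma IsAdmissible.boostForm_le {N S C X Y M : ℝ} (h : IsAdmissible N S C X Y M)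
    {δ b K : ℝ} (h1 : δ ≤ 1) (hK : Real.cosh b ≤ K)
    {e : ℂ} (he : ‖e‖ = 1) : boostForm δ b e S C X Y M ≤ (5 * K ^ 2 + 2 * K + 1) * N := by
  have hC := h.C_nonneg
  have hCN := h.C_le
  have hM := h.M_nonneg
  have hS0 := h.S_nonneg
  have hN : 0 ≤ N := hC.trans hCN
  have hc := (Real.cosh_pos b).le
  have hK0 := hc.trans hK
  have hs : |Real.sinh b| ≤ K :=
    (abs_le_of_sq_le_sq (by linarith [Real.cosh_sq_sub_sinh_sq b]) hc).trans hK
  have hc' : |Real.cosh b| ≤ K := by rwa [abs_of_nonneg hc]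
  have hS : |S| ≤ N := by rw [abs_of_nonneg hS0, h.S_eq]; linarith
  have hX : |X| ≤ N := (abs_le_of_sq_le_sq (by nlinarith [h.sq_sub_le]) hS0).trans
    ((le_abs_self S).trans hS)
  have hY : |Y| ≤ N := (abs_le_of_sq_le_sq (by nlinarith [h.sq_eq]) hS0).trans
    ((le_abs_self S).trans hS)
  have hre : |e.re| ≤ 1 := he ▸ Complex.abs_re_le_norm e
  have him : |e.im| ≤ 1 := he ▸ Complex.abs_im_le_norm e
  have mul_bound : ∀ {u v U V : ℝ}, |u| ≤ U → |v| ≤ V → |u * v| ≤ U * V := by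
    intro u v U V hu hv
    rw [abs_mul]
    exact mul_le_mul hu hv (abs_nonneg v) ((abs_nonneg u).trans hu)
  have hS' : |Real.cosh b * S - Real.sinh b * X| ≤ 2 * K * N := by
    have := (abs_sub _ _).trans (add_le_add (mul_bound hc' hS) (mul_bound hs hX))
    linarith
  have hX' : |Real.cosh b * X - Real.sinh b * S| ≤ 2 * K * N := by
    have := (abs_sub _ _).trans (add_le_add (mul_bound hc' hX) (mul_bound hs hS))
    linarith
  have hX'' : |e.re * (Real.cosh b * X - Real.sinh b * S) - e.im * Y| ≤ 2 * K * N + N := by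
    have := (abs_sub _ _).trans (add_le_add (mul_bound hre hX') (mul_bound him hY))
    linarith
  have h3 := mul_bound hc' hS'
  have h4 := mul_bound hs hX''
  have h5 := h.le_boost_boost b he
  have hK1 : 1 ≤ K := (Real.one_le_cosh b).trans hK
  have h6 : K * N ≤ K ^ 2 * N := mul_le_mul_of_nonneg_right (by nlinarith) hN
  have h7 := (le_abs_self _).trans hS'
  have h8 : δ * (Real.cosh b * (Real.cosh b * S - Real.sinh b * X)
      + Real.sinh b * (e.re * (Real.cosh b * X - Real.sinh b * S) - e.im * Y) + C / 2)
      ≤ 5 * K ^ 2 * N + N := by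
    refine (mul_le_of_le_one_left (by linarith) h1).trans ?_
    have h9 := (le_abs_self _).trans h3
    have h10 := (le_abs_self _).trans h4
    nlinarith
  unfold boostForm
  nlinarith

/-! ### Composition of contact isotopies -/

lemma IsContactIsotopy.trans {φ ψ : ℝ → V n ≃ₘ^∞⟮model n, model n⟯ V n} (hφ : IsContactIsotopy φ)
    (hψ : IsContactIsotopy ψ) : IsContactIsotopy fun s => (φ s).trans (ψ s) where
  smooth := by
    have h1 : ContMDiffOn (𝓘(ℝ, ℝ).prod (model n)) (𝓘(ℝ, ℝ).prod (model n)) ∞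
        (fun q : ℝ × V n => (q.1, φ q.1 q.2)) (Icc 0 1 ×ˢ univ) :=
      contMDiffOn_fst.prodMk hφ.smooth
    exact hψ.smooth.comp h1 fun q hq => ⟨hq.1, trivial⟩
  start p := by
    simp [hφ.start, hψ.start]
  contact s hs p v := by
    have hne : (∞ : WithTop ℕ∞) ≠ 0 := by simp
    have h1 : mfderiv (model n) (model n) ((φ s).trans (ψ s)) p
        = (mfderiv (model n) (model n) (ψ s) (φ s p)).comp (mfderiv (model n) (model n) (φ s) p) :=
      mfderiv_comp p ((ψ s).contMDiff.mdifferentiable hne _) ((φ s).contMDiff.mdifferentiable hne _)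
    rw [h1, ← hφ.contact s hs p v]
    exact hψ.contact s hs (φ s p) _

/-! ### Neighbourhoods of prequantized balls -/

lemma mem_prequantizedBall {R : ℝ} {p : V n} :
    p ∈ prequantizedBall n R ↔ Real.pi * nsq (incl p) < R := Iff.rfl

lemma continuous_nsq_incl : Continuous fun p : V n => nsq (incl p) :=
  contDiff_nsq.continuous.comp continuous_incl

lemma isCompact_setOf_nsq_le (c : ℝ) : IsCompact {p : V n | nsq (incl p) ≤ c} := by
  have h1 : IsCompact ((Metric.closedBall (0 : E n) (Real.sqrt c) ×ˢ
      Metric.closedBall (0 : E n) (Real.sqrt c)) ×ˢ (univ : Set Circle)) :=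
    ((isCompact_closedBall _ _).prod (isCompact_closedBall _ _)).prod isCompact_univ
  refine h1.of_isClosed_subset (isClosed_le continuous_nsq_incl continuous_const) fun p hp => ?_
  have hp' : ‖p.1.1‖ ^ 2 + ‖p.1.2‖ ^ 2 ≤ c := hp
  refine ⟨⟨?_, ?_⟩, trivial⟩ <;> rw [mem_closedBall_zero_iff] <;> apply Real.le_sqrt_of_sq_le
  · linarith [sq_nonneg ‖p.1.2‖]
  · linarith [sq_nonneg ‖p.1.1‖]

lemma mem_closure_prequantizedBall {R : ℝ} (hR : 0 < R) {p : V n}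
    (hp : Real.pi * nsq (incl p) ≤ R) :
    p ∈ closure (prequantizedBall n R) := by
  have hc : Continuous fun t : ℝ => ((t • p.1, p.2) : V n) := by fun_prop
  have h1 : Tendsto (fun t : ℝ => ((t • p.1, p.2) : V n)) (𝓝[<] 1) (𝓝 p) := by
    have := (hc.tendsto 1).mono_left (nhdsWithin_le_nhds (s := Iio 1))
    simpa using this
  refine mem_closure_of_tendsto h1 ?_
  have h0 : Ioo (0 : ℝ) 1 ∈ 𝓝[<] (1 : ℝ) := Ioo_mem_nhdsLT one_pos
  filter_upwards [h0] with t ht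
  have h2 : nsq (incl ((t • p.1, p.2) : V n)) = t ^ 2 * nsq (incl p) := by
    simp only [nsq, incl, Prod.smul_fst, Prod.smul_snd, norm_smul, mul_pow, Real.norm_eq_abs,
      sq_abs]
    ring
  rw [mem_prequantizedBall, h2]
  have h3 : t ^ 2 < 1 := by nlinarith [ht.1, ht.2]
  have h4 := nsq_nonneg (incl p)
  nlinarith [sq_nonneg t, mul_nonneg Real.pi_pos.le h4]

lemma le_of_mem_closure_prequantizedBall {R : ℝ} {p : V n}
    (hp : p ∈ closure (prequantizedBall n R)) : Real.pi * nsq (incl p) ≤ R := by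
  have h1 : IsClosed {p : V n | Real.pi * nsq (incl p) ≤ R} :=
    isClosed_le (continuous_const.mul continuous_nsq_incl) continuous_const
  exact closure_minimal (fun p hp => (mem_prequantizedBall.1 hp).le) h1 hp

/-- A neighbourhood of a closed prequantized ball contains a larger one, by compactness. -/
lemma exists_lt_setOf_nsq_le_subset {R : ℝ} (hR : 0 < R) {W : Set (V n)} (hW : IsOpen W)
    (h : closure (prequantizedBall n R) ⊆ W) :
    ∃ c, R / Real.pi < c ∧ {p : V n | nsq (incl p) ≤ c} ⊆ W := by
  have hpi := Real.pi_pos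
  have hK : IsCompact ({p : V n | nsq (incl p) ≤ R / Real.pi + 1} \ W) :=
    (isCompact_setOf_nsq_le _).diff hW
  rcases ({p : V n | nsq (incl p) ≤ R / Real.pi + 1} \ W).eq_empty_or_nonempty with h0 | h0
  · exact ⟨R / Real.pi + 1, by linarith, sdiff_eq_empty.1 h0⟩
  · obtain ⟨p, hp, hmin⟩ := hK.exists_isMinOn h0 continuous_nsq_incl.continuousOn
    have h1 : R / Real.pi < nsq (incl p) := by
      by_contra hcon
      rw [not_lt, le_div_iff₀ hpi] at hcon
      exact hp.2 (h (mem_closure_prequantizedBall hR (by linarith)))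
    obtain ⟨c, hc1, hc2⟩ := exists_between h1
    refine ⟨c, hc1, fun x (hx : nsq (incl x) ≤ c) => ?_⟩
    by_contra hxW
    have h2 : nsq (incl x) ≤ R / Real.pi + 1 := hx.trans (hc2.le.trans hp.1)
    have : nsq (incl p) ≤ nsq (incl x) := hmin ⟨h2, hxW⟩
    linarith

/-! ### Squeezing by a boosted loop of rotations -/

lemma rotAngle_zero : rotAngle 0 = Real.pi / 2 := by simp [rotAngle]

lemma rotAngle_one : rotAngle 1 = 0 := by simp [rotAngle]

lemma normSq_rot_le {i j : Fin n} (hij : i ≠ j) (s : ℝ) {p : Amb n} (hp : ‖p.2‖ = 1) :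
    Complex.normSq (rotFst (rotAngle s) p.2 (zc i p) (zc j p))
      + Complex.normSq (rotSnd (rotAngle s) p.2 (zc i p) (zc j p)) ≤ nsq p := by
  rw [normSq_rot _ hp]
  exact normSq_zc_add_le hij p

lemma exists_le_cosh (K : ℝ) : ∃ b, K ≤ Real.cosh b := by
  refine ⟨2 * K, ?_⟩
  have h1 := Real.add_one_le_exp (2 * K)
  have h2 := Real.exp_pos (-(2 * K))
  rw [Real.cosh_eq]
  linarith

/-- The loop of rotations in two coordinates is switched on: the ball `{π (k + δ) N ≤ 1}` is moved
into the domain of `(k + δ) N + |z_j|² - |z_i|²`, which is the unboosted `k N + boostQuad`. -/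
lemma exists_unwinding (k : ℕ) {δ c : ℝ} {i j : Fin n} (hij : i ≠ j) (h : 1 < k + δ)
    (hc : 1 / (Real.pi * (k + δ - 1)) < c) :
    ∃ φ : ℝ → V n ≃ₘ^∞⟮model n, model n⟯ V n, IsContactIsotopy φ ∧
      (∀ p, c < nsq (incl p) → ∀ s, φ s p = p) ∧
      (∀ p, Real.pi * ((k + δ) * nsq (incl p)) ≤ 1 →
        Real.pi * (k * nsq (incl (φ 1 p)) + boostQuad k δ 0 (nsq (incl (φ 1 p)))
          (zc j (incl (φ 1 p))) (zc i (incl (φ 1 p))) (incl (φ 1 p)).2) ≤ 1) := by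
  have hQ : IsQuadratic fun N _ _ _ => δ * N := by
    intro N ζ w e τ s _ hN _ _ _
    exact (hN.const_mul δ).congr_deriv (by ring)
  obtain ⟨φ, h1, h2, h3⟩ := exists_rotation_isotopy (κ := (k : ℝ)) (L := k + δ - 1)
    (Λ := k + δ + 1) hQ (by fun_prop) hij.symm (by linarith) hc
    (fun s _ p hp => by
      have h4 := normSq_rot_le hij.symm s hp
      have h5 := Complex.normSq_nonneg (rotFst (rotAngle s) p.2 (zc j p) (zc i p))
      have h6 := Complex.normSq_nonneg (zc j p)
      unfold rotForm
      linarith)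
    (fun s _ p hp => by
      have h4 := normSq_zc_add_le hij p
      have h5 := Complex.normSq_nonneg (rotSnd (rotAngle s) p.2 (zc j p) (zc i p))
      have h6 := Complex.normSq_nonneg (zc i p)
      unfold rotForm
      linarith)
  refine ⟨φ, h1, h2, fun p hp => ?_⟩
  have h4 := h3 p (by
    simp only [rotForm, rotAngle_zero, rotSnd, Real.sin_pi_div_two, Real.cos_pi_div_two]
    convert hp using 2
    simp
    ring)
  convert h4 using 2
  have h5 : Complex.normSq (rotSnd (rotAngle 1) (incl (φ 1 p)).2 (zc j (incl (φ 1 p)))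
      (zc i (incl (φ 1 p)))) = Complex.normSq (zc i (incl (φ 1 p))) := by
    rw [rotAngle_one, rotSnd]
    simp [Complex.normSq_eq_norm_sq, norm_incl_snd]
  rw [rotForm, h5, boostQuad, boostForm]
  simp
  ring

/-- The loop of rotations is conjugated by boosts of rapidities from `0` to `b`. No level set leaves
the neighbourhood of `{π (k + δ - 1) N ≤ 1}`, however large `b` is. -/
lemma exists_boosting (k : ℕ) {δ b c : ℝ} {i j : Fin n} (hij : i ≠ j) (h0 : 0 ≤ δ) (h1 : δ ≤ 1)
    (h : 1 < k + δ) (hc : 1 / (Real.pi * (k + δ - 1)) < c) :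
    ∃ φ : ℝ → V n ≃ₘ^∞⟮model n, model n⟯ V n, IsContactIsotopy φ ∧
      (∀ p, c < nsq (incl p) → ∀ s, φ s p = p) ∧
      (∀ p, Real.pi * (k * nsq (incl p) + boostQuad k δ 0 (nsq (incl p)) (zc j (incl p))
          (zc i (incl p)) (incl p).2) ≤ 1 →
        Real.pi * (k * nsq (incl (φ 1 p)) + boostQuad k δ b (nsq (incl (φ 1 p)))
          (zc j (incl (φ 1 p))) (zc i (incl (φ 1 p))) (incl (φ 1 p)).2) ≤ 1) := by
  refine exists_boost_isotopy k b hij (L := k + δ - 1)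
    (Λ := k + (5 * Real.cosh b ^ 2 + 2 * Real.cosh b + 1)) (by linarith) hc ?_ ?_
  · intro s _ p hp
    have h2 := (isAdmissible_coords k hp (normSq_zc_add_le hij.symm p)).boostForm_ge h0 h1
      (b * s) hp
    unfold boostQuad
    linarith
  · intro s hs p hp
    have hb : Real.cosh (b * s) ≤ Real.cosh b := by
      rw [Real.cosh_le_cosh, abs_mul, abs_of_nonneg hs.1]
      exact mul_le_of_le_one_right (abs_nonneg b) hs.2
    have h2 := (isAdmissible_coords k hp (normSq_zc_add_le hij.symm p)).boostForm_le h1 hb hp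
    unfold boostQuad
    linarith

/-- The loop of rotations is switched on once more, after a large boost; as the two rotations then
combine to a positive loop, the resulting domain lies inside the ball `{π (k + δ) N < 1}`. -/
lemma exists_contraction (k : ℕ) {δ ε b c : ℝ} {i j : Fin n} (hij : i ≠ j) (h0 : 0 ≤ δ)
    (h1 : δ ≤ 1) (hε : 0 ≤ ε) (h : 1 + ε < k + δ) (hc : 1 / (Real.pi * (k + δ - 1 - ε)) < c)
    (hb : 9 ≤ 1 + ε ^ 2 + 2 * ε * Real.cosh b)
    (hb' : 49 ≤ 1 + (1 - δ) ^ 2 + 2 * (1 - δ) * Real.cosh b) :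
    ∃ φ : ℝ → V n ≃ₘ^∞⟮model n, model n⟯ V n, IsContactIsotopy φ ∧
      (∀ p, c < nsq (incl p) → ∀ s, φ s p = p) ∧
      (∀ p, Real.pi * (k * nsq (incl p) + boostQuad k δ b (nsq (incl p)) (zc j (incl p))
          (zc i (incl p)) (incl p).2) ≤ 1 →
        Real.pi * ((k + δ) * nsq (incl (φ 1 p))) < 1) := by
  obtain ⟨φ, h2, h3, h4⟩ := exists_rotation_isotopy (κ := (k : ℝ)) (L := k + δ - 1 - ε)
    (Λ := k + 1 + (5 * Real.cosh b ^ 2 + 2 * Real.cosh b + 1)) (isQuadratic_boostQuad k δ b)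
    (continuous_boostQuad k δ continuous_const (by fun_prop) (by fun_prop) (by fun_prop)
      (by fun_prop)) hij (by linarith) hc
    (fun s _ p hp => by
      have h5 := (isAdmissible_coords k hp (normSq_rot_le hij s hp)).boostForm_sub_ge h0 h1 hε hb hp
      have h6 := Complex.normSq_nonneg (zc i p)
      unfold rotForm boostQuad
      linarith)
    (fun s _ p hp => by
      have h5 := (isAdmissible_coords k hp (normSq_rot_le hij s hp)).boostForm_le (b := b) h1
        le_rfl hp
      have h6 := Complex.normSq_nonneg (rotSnd (rotAngle s) p.2 (zc i p) (zc j p))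
      have h7 := Complex.normSq_nonneg (zc j p)
      have h8 := normSq_zc_add_le hij p
      unfold rotForm boostQuad
      linarith)
  refine ⟨φ, h2, h3, fun p hp => ?_⟩
  have h5 := h4 p (by
    have e1 : rotFst (rotAngle 0) (incl p).2 (zc i (incl p)) (zc j (incl p)) = zc j (incl p) := by
      rw [rotAngle_zero, rotFst]; simp
    have e2 : rotSnd (rotAngle 0) (incl p).2 (zc i (incl p)) (zc j (incl p)) = -zc i (incl p) := by
      rw [rotAngle_zero, rotSnd]; simp
    rw [rotForm, e1, e2, Complex.normSq_neg, add_sub_cancel_right]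
    simpa only [boostQuad, Complex.normSq_neg] using hp)
  set P := incl (φ 1 p) with hP
  have hP1 : ‖P.2‖ = 1 := norm_incl_snd _
  have hadm := isAdmissible_coords k hP1 (normSq_rot_le hij 1 hP1)
  have e1 : Complex.normSq (rotFst (rotAngle 1) P.2 (zc i P) (zc j P))
      = Complex.normSq (zc i P) := by
    rw [rotAngle_one, rotFst]; simp [Complex.normSq_eq_norm_sq, hP1]
  have e2 : Complex.normSq (rotSnd (rotAngle 1) P.2 (zc i P) (zc j P))
      = Complex.normSq (zc j P) := by
    rw [rotAngle_one, rotSnd]; simp [Complex.normSq_eq_norm_sq, hP1]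
  rcases (nsq_nonneg P).eq_or_lt with hN | hN
  · rw [← hN]; simp
  · have h6 := hadm.boostForm_gt h0 h1 hb' hP1 hN
    refine lt_of_lt_of_le (mul_lt_mul_of_pos_left ?_ Real.pi_pos) h5
    unfold rotForm boostQuad
    rw [e2] at h6 ⊢
    rw [e1] at h6 ⊢
    linarith

/-- The domain `π r (|x|² + |y|²) ≤ 1` is moved into its interior by a contact isotopy supported
in any neighbourhood of `π (r - 1) (|x|² + |y|²) ≤ 1`. -/
theorem exists_squeezing_isotopy (hn : 2 ≤ n) {r c : ℝ} (hr : 1 < r)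
    (hc : 1 / (Real.pi * (r - 1)) < c) :
    ∃ φ : ℝ → V n ≃ₘ^∞⟮model n, model n⟯ V n, IsContactIsotopy φ ∧
      (∀ p, c < nsq (incl p) → ∀ s, φ s p = p) ∧
      (∀ p, Real.pi * (r * nsq (incl p)) ≤ 1 → Real.pi * (r * nsq (incl (φ 1 p))) < 1) := by
  have hpi := Real.pi_pos
  have hr1 : 0 < r - 1 := by linarith
  have hij : (⟨0, by omega⟩ : Fin n) ≠ ⟨1, by omega⟩ := by simp
  have hc0 : 0 < c := lt_trans (by positivity) hc
  set k := ⌊r⌋₊ with hk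
  set δ := r - k with hδ
  have hrk : r = k + δ := by rw [hδ]; ring
  have h0 : 0 ≤ δ := sub_nonneg.2 (Nat.floor_le (by linarith))
  have h1 : δ < 1 := by linarith [Nat.lt_floor_add_one r]
  have hcL : 1 / (Real.pi * c) < r - 1 := by
    rw [div_lt_iff₀ (by positivity)] at hc ⊢
    linarith
  obtain ⟨L, hL1, hL2⟩ := exists_between hcL
  have hL0 : 0 < L := lt_trans (by positivity) hL1
  have hL : 1 / (Real.pi * L) < c := by
    rw [div_lt_iff₀ (by positivity)] at hL1 ⊢
    linarith
  set ε := r - 1 - L with hε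
  have hε0 : 0 < ε := by linarith
  have hδ0 : 0 < 1 - δ := by linarith
  obtain ⟨b, hb⟩ := exists_le_cosh (max (4 / ε) (24 / (1 - δ)))
  have hb1 : 4 ≤ ε * Real.cosh b := by
    have := (le_max_left _ _).trans hb
    rwa [div_le_iff₀ hε0, mul_comm] at this
  have hb2 : 24 ≤ (1 - δ) * Real.cosh b := by
    have := (le_max_right _ _).trans hb
    rwa [div_le_iff₀ hδ0, mul_comm] at this
  rw [hrk] at hr hc
  obtain ⟨φ, f1, f2, f3⟩ := exists_unwinding k hij hr hc
  obtain ⟨ψ, g1, g2, g3⟩ := exists_boosting k (b := b) hij h0 h1.le hr hc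
  obtain ⟨χ, q1, q2, q3⟩ := exists_contraction k (ε := ε) (b := b) (c := c) hij h0 h1.le hε0.le
    (by linarith) (by rwa [← hrk, hε, sub_sub_cancel]) (by nlinarith) (by nlinarith)
  refine ⟨_, (f1.trans g1).trans q1, fun p hp s => ?_, fun p hp => ?_⟩
  · simp [f2 p hp, g2 p hp, q2 p hp]
  · rw [hrk] at hp ⊢
    exact q3 _ (g3 _ (f3 p hp))

end ContactSqueezing

end

theorem mainTheorem9 (n m κ : ℕ) (hn : 2 ≤ n) (hm : 0 < m) (hmκ : m < κ)
    (W : Set (ContactSqueezing.V n)) (hW : IsOpen W)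
    (hBW : closure (ContactSqueezing.prequantizedBall n ((m : ℝ) / ((κ : ℝ) - (m : ℝ)))) ⊆ W) :
    ∃ φ : ℝ → ContactSqueezing.V n ≃ₘ^∞⟮ContactSqueezing.model n, ContactSqueezing.model n⟯
        ContactSqueezing.V n,
      ContactSqueezing.IsSqueezing φ
        (ContactSqueezing.prequantizedBall n ((m : ℝ) / (κ : ℝ)))
        (ContactSqueezing.prequantizedBall n ((m : ℝ) / (κ : ℝ))) W := by
  have hpi := Real.pi_pos
  have hm0 : (0 : ℝ) < m := by exact_mod_cast hm
  have hκm : (0 : ℝ) < κ - m := sub_pos.2 (by exact_mod_cast hmκ)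
  have hκ0 : (0 : ℝ) < κ := by linarith
  obtain ⟨c, hc, hcW⟩ := ContactSqueezing.exists_lt_setOf_nsq_le_subset (div_pos hm0 hκm) hW hBW
  have hr : (1 : ℝ) < κ / m := by rw [lt_div_iff₀ hm0]; linarith
  obtain ⟨φ, h1, h2, h3⟩ := ContactSqueezing.exists_squeezing_isotopy hn (c := c) hr (by
    convert hc using 1
    field_simp)
  refine ⟨φ, h1, ⟨_, ContactSqueezing.isCompact_setOf_nsq_le c, hcW,
    fun t _ p hp => h2 p (not_le.1 hp) t⟩, fun p hp => ?_⟩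
  have h4 := ContactSqueezing.le_of_mem_closure_prequantizedBall hp
  have h5 := h3 p (by
    rw [le_div_iff₀ hκ0] at h4
    rw [div_mul_eq_mul_div, mul_div_assoc', div_le_one hm0]
    linarith)
  rw [ContactSqueezing.mem_prequantizedBall, lt_div_iff₀ hκ0]
  rw [div_mul_eq_mul_div, mul_div_assoc', div_lt_one hm0] at h5
  linarith
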